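/- **Setting.** Let $\hat f,Q,\omega:[0,1]\to[0,\infty)$ be continuous, each of them vanishing exactly at $0$, with $\hat f(1)=1$, and let $\varphi:[0,\infty)\to[0,\infty)$ be such that * (Hp1) $Q$ and $f(t):=\big(\hat f(t)/Q(1-t)\big)^{1/2}$, $t\in[0,1)$, are increasing (i.e. non-decreasing) in a right neighbourhood of $0$; * (Hp2) the limit $\sigma:=\lim_{t\to0^+}(\omega(t)/Q(t))^{1/2}\in[0,\infty]$ exists; * (Hp3) $\varphi$ is continuous and non-decreasing, with $\lim_{t\to\infty}\varphi(t)\in(0,\infty)$; * (Hp4) $\varphi^{-1}(0)=\{0\}$ and $\varphi$ is right-differentiable at $0$ with $\varphi'(0^+)\in(0,\infty)$; we normalize $\varphi'(0^+)=1$; * (Hp5′) $\hat k(t):=\frac{\omega(1-t)}{Q(1-t)}\hat f(t)$, $t\in[0,1)$, satisfies $\hat k\in C^1((0,1))$ and $\hat k'>0$ on $(0,1)$. Extend $\hat k$ to $t=1$ by $\hat k(1):=\hat k(1^-)=\sigma^2\in[0,\infty]$, and use the convention $0\cdot\infty=0$. Put $\Psi(t):=\int_0^t\omega^{1/2}(1-\tau)\,d\tau$.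 For $s\ge 0$ define the surface energy density $$g(s):=\inf\int_0^1\Big(\varphi'(0^+)\,\hat k(\beta)|\gamma'|^2+\omega(1-\beta)|\beta'|^2\Big)^{1/2}dx,$$ the infimum being over $\gamma,\beta\in H^1((0,1))$ with $\gamma(0)=0$, $\gamma(1)=s$, $0\le\beta\le1$, $\beta(0)=\beta(1)=1$. Let $$s_{\rm frac}:=\sup\{s\in[0,\infty):\ g(s)<2\Psi(1)\}.$$ For $m\in(0,1)$ and $s\ge0$ let $G_{m,s}:L^1((2m-1,1))\to[0,\infty]$ be $$G_{m,s}(w):=\int_{2m-1}^1\Big(\hat k(m+|t-m|)\,|w'|^2+\omega\big(1-m-|t-m|\big)\Big)^{1/2}dt$$ if $w\in W^{1,1}((2m-1,1))$ with $w(2m-1)=0$, $w(1)=s$, and $G_{m,s}(w):=\infty$ otherwise. Let $sc^-G_{m,s}$ be its lower semicontinuous envelope in $L^1((2m-1,1))$, and let $\mathfrak G_s(m):=\inf_{w\in L^1((2m-1,1))}sc^-G_{m,s}(w)$ be its minimum value. Finally, for $x\in(0,1)$ let $$\Phi(x):=2\int_x^1\Big(\frac{\hat k(x)\,\omega(1-t)}{\hat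 k(t)\,(\hat k(t)-\hat k(x))}\Big)^{1/2}dt\in[0,\infty],$$ and let $\inf\Phi$ and $\sup\Phi$ be taken over $(0,1)$. **Proposition.** Under these assumptions: 1. $g(s)=\sigma s$ for every $s\in[0,\infty)$ with $s\le\inf\Phi$; moreover $\inf\Phi=0$ if $\hat k(1^-)=\infty$. 2. For every $s\in(\inf\Phi,\sup\Phi)$, $$g(s)=\min\Big\{\inf_{m\in(0,1),\ \Phi(m)=s}\mathfrak G_s(m),\ \liminf_{m\to0^+}\mathfrak G_s(m),\ \liminf_{m\to1^-}\mathfrak G_s(m)\Big\}.$$ 3. $g(s)=2\Psi(1)$ for every $s\in[\sup\Phi,\infty)$. In particular, $s_{\rm frac}\in[\inf\Phi,\sup\Phi]$. -/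

import Mathlib

open MeasureTheory Set Filter Topology
open scoped ENNReal NNReal

noncomputable section

namespace CohesiveFracture

/-- The ingredients of the phase-field model. The functions `fhat`, `Q`, `ω` matter only on `[0,1]`
and `φ` only on `[0,∞)`; `σ` is the limit of `(ω/Q)^(1/2)` at `0⁺` (see `Hp2`). -/
structure Model where
  fhat : ℝ → ℝ
  Q : ℝ → ℝ
  ω : ℝ → ℝ
  φ : ℝ → ℝ
  σ : ℝ≥0∞

namespace Model

variable (M : Model)

/-- `f(t) = (fhat(t) / Q(1-t))^(1/2)` for `t ∈ [0,1)`. -/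
def f (t : ℝ) : ℝ := Real.sqrt (M.fhat t / M.Q (1 - t))

structure Hp1 : Prop where
  continuousOn_fhat : ContinuousOn M.fhat (Icc 0 1)
  continuousOn_Q : ContinuousOn M.Q (Icc 0 1)
  fhat_nonneg : ∀ t ∈ Icc (0 : ℝ) 1, 0 ≤ M.fhat t
  Q_nonneg : ∀ t ∈ Icc (0 : ℝ) 1, 0 ≤ M.Q t
  fhat_one : M.fhat 1 = 1
  fhat_eq_zero_iff : ∀ t ∈ Icc (0 : ℝ) 1, M.fhat t = 0 ↔ t = 0
  Q_eq_zero_iff : ∀ t ∈ Icc (0 : ℝ) 1, M.Q t = 0 ↔ t = 0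
  Q_monotone : ∃ δ ∈ Ioo (0 : ℝ) 1, MonotoneOn M.Q (Icc 0 δ)
  f_monotone : ∃ δ ∈ Ioo (0 : ℝ) 1, MonotoneOn M.f (Icc 0 δ)

structure Hp2 : Prop where
  continuousOn_ω : ContinuousOn M.ω (Icc 0 1)
  ω_nonneg : ∀ t ∈ Icc (0 : ℝ) 1, 0 ≤ M.ω t
  ω_eq_zero_iff : ∀ t ∈ Icc (0 : ℝ) 1, M.ω t = 0 ↔ t = 0
  tendsto_σ :
    Tendsto (fun t => ENNReal.ofReal (Real.sqrt (M.ω t / M.Q t))) (𝓝[>] 0) (𝓝 M.σ)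

structure Hp3 : Prop where
  continuousOn_φ : ContinuousOn M.φ (Ici 0)
  φ_nonneg : ∀ t ∈ Ici (0 : ℝ), 0 ≤ M.φ t
  φ_monotone : MonotoneOn M.φ (Ici 0)
  tendsto_φ : ∃ L : ℝ, 0 < L ∧ Tendsto M.φ atTop (𝓝 L)

structure Hp4 : Prop where
  φ_eq_zero_iff : ∀ t ∈ Ici (0 : ℝ), M.φ t = 0 ↔ t = 0
  differentiable_φ : ∃ d : ℝ, 0 < d ∧ HasDerivWithinAt M.φ d (Ici 0) 0

/-- `φ'(0⁺)`. -/
def phiPrime : ℝ := derivWithin M.φ (Ici 0) 0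

/-- The (real-valued) function `khat(t) = ω(1-t)/Q(1-t) * fhat(t)`, meaningful for `t ∈ [0,1)`. -/
def khat (t : ℝ) : ℝ := M.ω (1 - t) / M.Q (1 - t) * M.fhat t

structure Hp5' : Prop where
  contDiffOn_khat : ContDiffOn ℝ 1 M.khat (Ioo 0 1)
  deriv_khat_pos : ∀ t ∈ Ioo (0 : ℝ) 1, 0 < deriv M.khat t

/-- `khat` on `[0,1]` with values in `[0,∞]`: it is extended to `t = 1` by its limit
`khat(1⁻) = σ²` (recall `fhat(1) = 1`). -/
def khatExt (t : ℝ) : ℝ≥0∞ := if t < 1 then ENNReal.ofReal (M.khat t) else M.σ ^ 2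

/-- `Ψ(t) = ∫₀ᵗ ω(1-τ)^(1/2) dτ`. -/
def Psi (t : ℝ) : ℝ := ∫ τ in (0 : ℝ)..t, Real.sqrt (M.ω (1 - τ))

end Model

/-- `u` is (the continuous representative of) a function in `H¹((0,1))`. -/
def MemH1 (u : ℝ → ℝ) : Prop :=
  AbsolutelyContinuousOnInterval u 0 1 ∧ MemLp (deriv u) 2 (volume.restrict (Ioo 0 1))

/-- The admissible pairs `(γ, β)` in the minimum problem that defines `g(s)`. -/
def admissible (s : ℝ) : Set ((ℝ → ℝ) × (ℝ → ℝ)) :=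
  {p | MemH1 p.1 ∧ MemH1 p.2 ∧ p.1 0 = 0 ∧ p.1 1 = s ∧
    (∀ x ∈ Icc (0 : ℝ) 1, 0 ≤ p.2 x ∧ p.2 x ≤ 1) ∧ p.2 0 = 1 ∧ p.2 1 = 1}

/-- The lower semicontinuous envelope: the largest lower semicontinuous function below `F`. -/
def lscEnvelope {X : Type*} [TopologicalSpace X] (F : X → ℝ≥0∞) (x : X) : ℝ≥0∞ :=
  ⨆ (H : X → ℝ≥0∞) (_ : LowerSemicontinuous H) (_ : ∀ y, H y ≤ F y), H x

namespace Model

variable (M : Model)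

/-- The energy `∫₀¹ (ω(1-β) (φ'(0⁺) f(β)² |γ'|² + |β'|²))^(1/2) dx`, where `ω(1-β) f(β)²` is
`khat(β)`, extended by continuity to `β = 1`, and `0 * ∞ = 0`. -/
def energy (γ β : ℝ → ℝ) : ℝ≥0∞ :=
  ∫⁻ x in Ioo (0 : ℝ) 1,
    (ENNReal.ofReal M.phiPrime * (M.khatExt (β x) * ENNReal.ofReal ((deriv γ x) ^ 2))
      + ENNReal.ofReal (M.ω (1 - β x) * (deriv β x) ^ 2)) ^ (1 / 2 : ℝ)

/-- The surface energy density `g`. -/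
def g (s : ℝ) : ℝ≥0∞ := ⨅ p ∈ admissible s, M.energy p.1 p.2

/-- The functional `G_m` on (continuous representatives of) functions in `W^{1,1}((2m-1,1))`.
The point `m + |t - m|` is `t` if `t ≥ m`, and the reflection of `t` in `m` otherwise. -/
def Gm (m : ℝ) (u : ℝ → ℝ) : ℝ≥0∞ :=
  ∫⁻ t in Ioo (2 * m - 1) 1,
    (M.khatExt (m + |t - m|) * ENNReal.ofReal ((deriv u t) ^ 2)
      + ENNReal.ofReal (M.ω (1 - (m + |t - m|)))) ^ (1 / 2 : ℝ)

/-- The functional `G_{m,s}` on `L¹((2m-1,1))`: it is `G_m(u)` if `w` agrees almost everywhere with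
an absolutely continuous `u` with `u(2m-1) = 0` and `u(1) = s`, and `∞` if there is no such `u`. -/
def Gms (m s : ℝ) (w : Lp ℝ 1 (volume.restrict (Ioo (2 * m - 1) 1))) : ℝ≥0∞ :=
  ⨅ (u : ℝ → ℝ) (_ : AbsolutelyContinuousOnInterval u (2 * m - 1) 1)
    (_ : u (2 * m - 1) = 0) (_ : u 1 = s)
    (_ : w =ᵐ[volume.restrict (Ioo (2 * m - 1) 1)] u), M.Gm m u

/-- `𝔊_s(m)`: the minimum value over `L¹((2m-1,1))` of the `L¹`-lower semicontinuous envelope of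
`G_{m,s}`. -/
def frakG (s m : ℝ) : ℝ≥0∞ :=
  ⨅ w : Lp ℝ 1 (volume.restrict (Ioo (2 * m - 1) 1)), lscEnvelope (M.Gms m s) w

/-- `B(m,λ) = 2 ∫ₘ¹ (λ² ω(1-t) / (khat(t) (khat(t) - λ²)))^(1/2) dt`. -/
def B (m l : ℝ) : ℝ≥0∞ :=
  2 * ∫⁻ t in Ioo m 1,
    ENNReal.ofReal (Real.sqrt (l ^ 2 * M.ω (1 - t) / (M.khat t * (M.khat t - l ^ 2))))

/-- `Φ(x) = B(x, khat(x)^(1/2))` for `x ∈ (0,1)`. -/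
def Phi (x : ℝ) : ℝ≥0∞ := M.B x (Real.sqrt (M.khat x))

def infPhi : ℝ≥0∞ := ⨅ x ∈ Ioo (0 : ℝ) 1, M.Phi x

def supPhi : ℝ≥0∞ := ⨆ x ∈ Ioo (0 : ℝ) 1, M.Phi x

/-- `s_frac = sup {s ∈ [0,∞) : g(s) < 2 Ψ(1)}`. -/
def sFrac : ℝ≥0∞ := ⨆ (s : ℝ≥0) (_ : M.g s < ENNReal.ofReal (2 * M.Psi 1)), (s : ℝ≥0∞)

end Model

end CohesiveFracture

end

/-! The integrand of `g` is the length element of the degenerate metric khat(β) dγ² + ω(1-β) dβ², so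
g(s) is the infimum of the lengths of curves from (0,1) to (s,1). Sort the curves by their lowest
height m. If l² ≤ khat(m), the Cauchy–Schwarz inequality bounds the length element below by l γ' +
`slack l β` |β'| (`le_density`). A curve that comes down to m and returns to 1 therefore has length
at least `dual s m l`, and hence at least the supremum `maxDual s m` of these bounds over l.

This duality has no gap. A geodesic with Clairaut constant l, completed near the height m by the
displacement it lacks, comes arbitrarily close to `maxDual s m` for a suitable l
(`exists_competitor_le`). Hence `frakG s m = maxDual s m` on (0,1) (`frakG_eq_maxDual`), and g(s) is
the infimum of `maxDual s` over (0,1) (`g_le_maxDual`, `le_g`); curves with lowest height 0 or 1 are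
covered by the limits 2Ψ(1) and σs of `maxDual s` at the two ends.

It remains to find the best height. The l-derivative of `dual s m l` is s minus the displacement of
the geodesic, which at l² = khat(m) becomes s - Φ(m). If Φ(m) > s, some larger height is strictly
better (`exists_gt_maxDual_lt`); if Φ(m) < s, some smaller one is (`exists_lt_maxDual_lt`). As
`maxDual s` is lower semicontinuous, its infimum is a limit at an end of (0,1) or is attained where
Φ(m) = s. Only the end 1 survives if s ≤ inf Φ, and only the end 0 if s ≥ sup Φ. -/

namespace CohesiveFracture.Model

variable (M : Model)

/-! ### Regularity of the two weights -/

/-- The weight `ω(1-t)^(1/2)` of `|β'|`. -/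
noncomputable def wt (t : ℝ) : ℝ := Real.sqrt (M.ω (1 - t))

/-- The properties of the two weights `khat` and `ω(1-·)` on which the proof rests. -/
structure Regular : Prop where
  continuousOn_wt : ContinuousOn M.wt (Icc 0 1)
  wt_pos : ∀ t ∈ Ico (0 : ℝ) 1, 0 < M.wt t
  wt_one : M.wt 1 = 0
  wt_sq : ∀ t ∈ Icc (0 : ℝ) 1, M.wt t ^ 2 = M.ω (1 - t)
  continuousOn_khat : ContinuousOn M.khat (Ico 0 1)
  khat_zero : M.khat 0 = 0
  strictMonoOn_khat : StrictMonoOn M.khat (Ico 0 1)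
  hasDerivAt_khat : ∀ t ∈ Ioo (0 : ℝ) 1, HasDerivAt M.khat (deriv M.khat t) t
  deriv_khat_pos : ∀ t ∈ Ioo (0 : ℝ) 1, 0 < deriv M.khat t
  tendsto_khat : Tendsto (fun t => ENNReal.ofReal (M.khat t)) (𝓝[<] 1) (𝓝 (M.σ ^ 2))
  tendsto_sqrt_khat :
    Tendsto (fun t => ENNReal.ofReal (Real.sqrt (M.khat t))) (𝓝[<] 1) (𝓝 M.σ)
  phiPrime_eq : M.phiPrime = 1

variable {M}

theorem regular_of_hypotheses (h1 : M.Hp1) (h2 : M.Hp2) (hφ : M.phiPrime = 1) (h5 : M.Hp5') :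
    M.Regular := by
  have hsub : MapsTo (fun t : ℝ => 1 - t) (Icc 0 1) (Icc 0 1) := fun t ht =>
    ⟨by linarith [ht.2], by linarith [ht.1]⟩
  have hsubc : ContinuousOn (fun t : ℝ => 1 - t) (Icc 0 1) := by fun_prop
  have hω : ContinuousOn (fun t => M.ω (1 - t)) (Icc 0 1) := h2.continuousOn_ω.comp hsubc hsub
  have hQ : ContinuousOn (fun t => M.Q (1 - t)) (Icc 0 1) := h1.continuousOn_Q.comp hsubc hsub
  have hIco : Ico (0 : ℝ) 1 ⊆ Icc 0 1 := Ico_subset_Icc_self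
  have hk : ContinuousOn M.khat (Ico 0 1) := by
    refine ((hω.mono hIco).div (hQ.mono hIco) fun t ht h => ?_).mul (h1.continuousOn_fhat.mono hIco)
    have := (h1.Q_eq_zero_iff _ (hsub (hIco ht))).1 h
    linarith [ht.2]
  have hf0 : M.fhat 0 = 0 := (h1.fhat_eq_zero_iff 0 ⟨le_rfl, zero_le_one⟩).2 rfl
  have hω0 : M.ω 0 = 0 := (h2.ω_eq_zero_iff 0 ⟨le_rfl, zero_le_one⟩).2 rfl
  have hmono : StrictMonoOn M.khat (Ico 0 1) :=
    strictMonoOn_of_deriv_pos (convex_Ico 0 1) hk (by simpa using h5.deriv_khat_pos)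
  have h01 : Tendsto (fun t : ℝ => 1 - t) (𝓝[<] 1) (𝓝[>] 0) := by
    refine tendsto_nhdsWithin_iff.2 ⟨?_, ?_⟩
    · exact (Continuous.tendsto' (by fun_prop) 1 0 (by simp)).mono_left nhdsWithin_le_nhds
    · filter_upwards [self_mem_nhdsWithin] with t ht
      simpa using ht
  have hev : ∀ᶠ t : ℝ in 𝓝[<] 1, t ∈ Ico (0 : ℝ) 1 := by
    filter_upwards [Ioo_mem_nhdsLT (zero_lt_one' ℝ)] with t ht using ⟨ht.1.le, ht.2⟩
  have hf1 : Tendsto M.fhat (𝓝[<] 1) (𝓝 1) := by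
    have := h1.continuousOn_fhat 1 ⟨zero_le_one, le_rfl⟩
    rw [ContinuousWithinAt, h1.fhat_one] at this
    exact this.mono_left (nhdsWithin_le_of_mem (mem_of_superset hev hIco))
  have hlim : Tendsto (fun t => ENNReal.ofReal (Real.sqrt (M.khat t))) (𝓝[<] 1) (𝓝 M.σ) := by
    have e1 := h2.tendsto_σ.comp h01
    have e2 : Tendsto (fun t => ENNReal.ofReal (Real.sqrt (M.fhat t))) (𝓝[<] 1) (𝓝 1) := by
      have := ENNReal.tendsto_ofReal ((Real.continuous_sqrt.tendsto 1).comp hf1)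
      simpa using this
    -- The limit of ω/Q may be infinite; the product converges because the other factor tends to 1,
    -- which is neither 0 nor ∞.
    have e3 := ENNReal.Tendsto.mul e1 (Or.inr ENNReal.one_ne_top) e2 (Or.inl one_ne_zero)
    rw [mul_one] at e3
    refine e3.congr' ?_
    filter_upwards [hev] with t ht
    rw [khat, Real.sqrt_mul, ENNReal.ofReal_mul (Real.sqrt_nonneg _)]
    · rfl
    · exact div_nonneg (h2.ω_nonneg _ (hsub (hIco ht))) (h1.Q_nonneg _ (hsub (hIco ht)))
  have hk0 : M.khat 0 = 0 := by simp [khat, hf0]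
  refine ⟨Real.continuous_sqrt.comp_continuousOn hω, fun t ht => ?_, by simp [wt, hω0], fun t ht =>
    Real.sq_sqrt (h2.ω_nonneg _ (hsub ht)), hk, hk0, hmono, fun t ht => ?_,
    h5.deriv_khat_pos, ?_, hlim, hφ⟩
  · refine Real.sqrt_pos.2 (lt_of_le_of_ne (h2.ω_nonneg _ (hsub (hIco ht))) fun h => ?_)
    have := (h2.ω_eq_zero_iff _ (hsub (hIco ht))).1 h.symm
    linarith [ht.2]
  · exact (((h5.contDiffOn_khat t ht).contDiffAt (isOpen_Ioo.mem_nhds ht)).differentiableAt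
      one_ne_zero).hasDerivAt
  · refine (ENNReal.Tendsto.pow (n := 2) hlim).congr' ?_
    filter_upwards [hev] with t ht
    rw [← ENNReal.ofReal_pow (Real.sqrt_nonneg _), Real.sq_sqrt]
    rw [← hk0]
    exact hmono.monotoneOn ⟨le_rfl, one_pos⟩ ht ht.1

/-! ### Pointwise calibration inequalities -/

/-- `ω(1-t)^(1/2) (1 - l²/khat(t))^(1/2)`, the weight of `|β'|` in the calibration with slope `l`. -/
noncomputable def slack (M : Model) (l t : ℝ) : ℝ := M.wt t * Real.sqrt (1 - l ^ 2 / M.khat t)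

/-- The integrand of `B(m,l)`: the slope of a geodesic with Clairaut constant `l`. -/
noncomputable def slope (M : Model) (l t : ℝ) : ℝ :=
  Real.sqrt (l ^ 2 * M.ω (1 - t) / (M.khat t * (M.khat t - l ^ 2)))

/-- The lower bound for the energy of paths from `(0,1)` to `(s,1)` that reach the height `m`
given by the calibration with slope `l`. -/
noncomputable def dual (M : Model) (s m l : ℝ) : ℝ := l * s + 2 * ∫ t in m..1, M.slack l t

theorem slack_nonneg (M : Model) (l t : ℝ) : 0 ≤ M.slack l t :=
  mul_nonneg (Real.sqrt_nonneg _) (Real.sqrt_nonneg _)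

theorem slope_nonneg (M : Model) (l t : ℝ) : 0 ≤ M.slope l t := Real.sqrt_nonneg _

theorem slack_zero (M : Model) (t : ℝ) : M.slack 0 t = M.wt t := by simp [slack]

theorem slope_zero (M : Model) (t : ℝ) : M.slope 0 t = 0 := by simp [slope]

namespace Regular

theorem khat_nonneg (H : M.Regular) {t : ℝ} (ht : t ∈ Ico (0 : ℝ) 1) : 0 ≤ M.khat t := by
  rw [← H.khat_zero]
  exact H.strictMonoOn_khat.monotoneOn ⟨le_rfl, one_pos⟩ ht ht.1

theorem khat_pos (H : M.Regular) {t : ℝ} (ht : t ∈ Ioo (0 : ℝ) 1) : 0 < M.khat t := by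
  rw [← H.khat_zero]
  exact H.strictMonoOn_khat ⟨le_rfl, one_pos⟩ ⟨ht.1.le, ht.2⟩ ht.1

theorem khat_mono (H : M.Regular) {x y : ℝ} (hx : 0 ≤ x) (hxy : x ≤ y) (hy : y < 1) :
    M.khat x ≤ M.khat y :=
  H.strictMonoOn_khat.monotoneOn ⟨hx, hxy.trans_lt hy⟩ ⟨hx.trans hxy, hy⟩ hxy

theorem khat_lt (H : M.Regular) {x y : ℝ} (hx : 0 ≤ x) (hxy : x < y) (hy : y < 1) :
    M.khat x < M.khat y :=
  H.strictMonoOn_khat ⟨hx, hxy.trans hy⟩ ⟨hx.trans hxy.le, hy⟩ hxy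

theorem ofReal_khat_le (H : M.Regular) {t : ℝ} (ht : t ∈ Ico (0 : ℝ) 1) :
    ENNReal.ofReal (M.khat t) ≤ M.σ ^ 2 := by
  refine ge_of_tendsto H.tendsto_khat ?_
  filter_upwards [Ioo_mem_nhdsLT ht.2] with x hx
  exact ENNReal.ofReal_le_ofReal (H.khat_mono ht.1 hx.1.le hx.2)

theorem sqrt_khat_le (H : M.Regular) {t : ℝ} (ht : t ∈ Ico (0 : ℝ) 1) :
    ENNReal.ofReal (Real.sqrt (M.khat t)) ≤ M.σ := by
  refine ge_of_tendsto H.tendsto_sqrt_khat ?_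
  filter_upwards [Ioo_mem_nhdsLT ht.2] with x hx
  exact ENNReal.ofReal_le_ofReal (Real.sqrt_le_sqrt (H.khat_mono ht.1 hx.1.le hx.2))

theorem σ_pos (H : M.Regular) : 0 < M.σ := by
  have h2 : (1 / 2 : ℝ) ∈ Ioo (0 : ℝ) 1 := by norm_num
  exact lt_of_lt_of_le (ENNReal.ofReal_pos.2 (Real.sqrt_pos.2 (H.khat_pos h2)))
    (H.sqrt_khat_le ⟨h2.1.le, h2.2⟩)

theorem slack_le_wt (H : M.Regular) {l t : ℝ} (ht : t ∈ Icc (0 : ℝ) 1) : M.slack l t ≤ M.wt t := by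
  rcases ht.2.eq_or_lt with rfl | h
  · simp [slack, H.wt_one]
  · refine mul_le_of_le_one_right (Real.sqrt_nonneg _) (Real.sqrt_le_one.2 ?_)
    have := div_nonneg (sq_nonneg l) (H.khat_nonneg ⟨ht.1, h⟩)
    linarith

/-- The real value `khat 1` is not the limit of `khat` at 1, so continuity there comes from
squeezing between 0 and `wt`, which vanishes at 1. The case l = 0 is separate because `khat m`
vanishes for m = 0. -/
theorem continuousOn_slack (H : M.Regular) {m l : ℝ} (hm : m ∈ Ico (0 : ℝ) 1)
    (hl : l ^ 2 ≤ M.khat m) : ContinuousOn (M.slack l) (Icc m 1) := by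
  rcases eq_or_ne l 0 with rfl | hl0
  · refine (H.continuousOn_wt.mono (Icc_subset_Icc_left hm.1)).congr fun t _ => M.slack_zero t
  intro t ht
  rcases ht.2.eq_or_lt with rfl | h
  · have h0 : M.slack l 1 = 0 := by simp [slack, H.wt_one]
    rw [ContinuousWithinAt, h0]
    have hw := H.continuousOn_wt 1 ⟨zero_le_one, le_rfl⟩
    rw [ContinuousWithinAt, H.wt_one] at hw
    refine tendsto_of_tendsto_of_tendsto_of_le_of_le' tendsto_const_nhds
      (hw.mono_left (nhdsWithin_mono _ (Icc_subset_Icc_left hm.1))) ?_ ?_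
    · exact Eventually.of_forall fun x => M.slack_nonneg l x
    · filter_upwards [self_mem_nhdsWithin] with x hx
      exact H.slack_le_wt ⟨hm.1.trans hx.1, hx.2⟩
  · have hk : M.khat t ≠ 0 := by
      have := pow_pos (abs_pos.2 hl0) 2
      rw [sq_abs] at this
      have h2 := H.khat_mono hm.1 ht.1 h
      exact ne_of_gt (by linarith)
    have hc : ContinuousWithinAt M.khat (Icc m 1) t :=
      (H.continuousOn_khat t ⟨hm.1.trans ht.1, h⟩).mono_of_mem_nhdsWithin (by
        filter_upwards [self_mem_nhdsWithin, mem_nhdsWithin_of_mem_nhds (Iio_mem_nhds h)]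
          with x hx hx' using ⟨hm.1.trans hx.1, hx'⟩)
    exact ((H.continuousOn_wt t ⟨hm.1.trans ht.1, ht.2⟩).mono (Icc_subset_Icc_left hm.1)).mul
      (Real.continuous_sqrt.continuousAt.comp_continuousWithinAt
        (continuousWithinAt_const.sub (continuousWithinAt_const.div hc hk)))

theorem intervalIntegrable_slack (H : M.Regular) {m l x y : ℝ} (hm : m ∈ Ico (0 : ℝ) 1)
    (hl : l ^ 2 ≤ M.khat m) (hx : x ∈ Icc m 1) (hy : y ∈ Icc m 1) :
    IntervalIntegrable (M.slack l) volume x y :=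
  ((H.continuousOn_slack hm hl).mono (uIcc_subset_Icc hx hy)).intervalIntegrable

theorem intervalIntegrable_wt (H : M.Regular) {x y : ℝ} (hx : x ∈ Icc (0 : ℝ) 1)
    (hy : y ∈ Icc (0 : ℝ) 1) : IntervalIntegrable M.wt volume x y :=
  (H.continuousOn_wt.mono (uIcc_subset_Icc hx hy)).intervalIntegrable

/-- In this form `slope` is visibly minus the l-derivative of `slack`, so the l-derivative of `dual
s m l` is s minus twice the integral of `slope`. -/
theorem slope_eq (H : M.Regular) {l t : ℝ} (ht : t ∈ Ico (0 : ℝ) 1) (hl0 : 0 ≤ l)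
    (hl : l ^ 2 < M.khat t) :
    M.slope l t = l * M.wt t / (M.khat t * Real.sqrt (1 - l ^ 2 / M.khat t)) := by
  have hk : 0 < M.khat t := lt_of_le_of_lt (sq_nonneg l) hl
  have hw : 0 < 1 - l ^ 2 / M.khat t := by rw [sub_pos, div_lt_one hk]; exact hl
  have hne : M.khat t - l ^ 2 ≠ 0 := by linarith
  have ha : 0 ≤ M.wt t := Real.sqrt_nonneg _
  rw [slope, ← H.wt_sq t ⟨ht.1, ht.2.le⟩, Real.sqrt_eq_iff_eq_sq
    (div_nonneg (by positivity) (mul_nonneg hk.le (by linarith))) (by positivity), div_pow, mul_pow,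
    mul_pow, Real.sq_sqrt hw.le]
  field_simp

/-- The calibration is exact along a geodesic with Clairaut constant `l`. -/
theorem sqrt_slope_eq (H : M.Regular) {l t : ℝ} (ht : t ∈ Ico (0 : ℝ) 1) (hl0 : 0 ≤ l)
    (hl : l ^ 2 < M.khat t) :
    Real.sqrt (M.khat t * M.slope l t ^ 2 + M.ω (1 - t)) = l * M.slope l t + M.slack l t := by
  have hk : 0 < M.khat t := lt_of_le_of_lt (sq_nonneg l) hl
  have hw : 0 < 1 - l ^ 2 / M.khat t := by rw [sub_pos, div_lt_one hk]; exact hl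
  have ha : 0 ≤ M.wt t := Real.sqrt_nonneg _
  have hnn := add_nonneg (mul_nonneg hl0 (M.slope_nonneg l t)) (M.slack_nonneg l t)
  rw [← H.wt_sq t ⟨ht.1, ht.2.le⟩, Real.sqrt_eq_iff_eq_sq (by positivity) hnn, slack,
    H.slope_eq ht hl0 hl]
  set w := Real.sqrt (1 - l ^ 2 / M.khat t) with hwdef
  have hw2 : w ^ 2 = 1 - l ^ 2 / M.khat t := Real.sq_sqrt hw.le
  have hwp : 0 < w := Real.sqrt_pos.2 hw
  have hl2 : l ^ 2 = M.khat t * (1 - w ^ 2) := by rw [hw2]; field_simp; ring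
  field_simp
  linear_combination -(M.wt t ^ 2) * hl2

/-- The tangent line inequality for the concave function `l ↦ slack l t`. -/
theorem slack_le_slack_add (H : M.Regular) {l l' t : ℝ} (ht : t ∈ Ico (0 : ℝ) 1) (hl0 : 0 ≤ l)
    (hl : l ^ 2 < M.khat t) (hl' : l' ^ 2 ≤ M.khat t) :
    M.slack l' t ≤ M.slack l t + (l - l') * M.slope l t := by
  have hk : 0 < M.khat t := lt_of_le_of_lt (sq_nonneg l) hl
  have hw : 0 < 1 - l ^ 2 / M.khat t := by rw [sub_pos, div_lt_one hk]; exact hl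
  have hw' : 0 ≤ 1 - l' ^ 2 / M.khat t := by rw [sub_nonneg, div_le_one hk]; exact hl'
  rw [slack, slack, H.slope_eq ht hl0 hl]
  set w := Real.sqrt (1 - l ^ 2 / M.khat t) with hwdef
  set w' := Real.sqrt (1 - l' ^ 2 / M.khat t) with hwdef'
  have hw2 : w ^ 2 = 1 - l ^ 2 / M.khat t := Real.sq_sqrt hw.le
  have hw2' : w' ^ 2 = 1 - l' ^ 2 / M.khat t := Real.sq_sqrt hw'
  have hwp : 0 < w := Real.sqrt_pos.2 hw
  have hl2 : l ^ 2 = M.khat t * (1 - w ^ 2) := by rw [hw2]; field_simp; ring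
  have hl2' : l' ^ 2 = M.khat t * (1 - w' ^ 2) := by rw [hw2']; field_simp; ring
  -- Both (l, √khat w) and (l', √khat w') lie on the circle of radius √khat, so the right side minus
  -- the left is half of (l - l')² + khat (w - w')².
  have key : w' * (M.khat t * w) ≤ w * (M.khat t * w) + (l - l') * l := by
    nlinarith [sq_nonneg (l - l'), mul_nonneg hk.le (sq_nonneg (w - w'))]
  have : w' ≤ w + (l - l') * l / (M.khat t * w) := by
    rw [← sub_le_iff_le_add', le_div_iff₀ (by positivity)]
    linarith
  calc M.wt t * w' ≤ M.wt t * (w + (l - l') * l / (M.khat t * w)) :=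
        mul_le_mul_of_nonneg_left this (Real.sqrt_nonneg _)
    _ = _ := by ring

theorem _root_.ENNReal.ofReal_rpow_half {x : ℝ} (hx : 0 ≤ x) :
    ENNReal.ofReal x ^ (1 / 2 : ℝ) = ENNReal.ofReal (Real.sqrt x) := by
  rw [ENNReal.ofReal_rpow_of_nonneg hx (by norm_num), Real.sqrt_eq_rpow]

/-- The energy density is the square root of a real quadratic form below the height `1`. -/
theorem density_eq (H : M.Regular) {t : ℝ} (p b : ℝ) (ht : t ∈ Ico (0 : ℝ) 1) :
    (M.khatExt t * ENNReal.ofReal (p ^ 2) + ENNReal.ofReal (M.ω (1 - t) * b ^ 2)) ^ (1 / 2 : ℝ) =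
      ENNReal.ofReal (Real.sqrt (M.khat t * p ^ 2 + M.ω (1 - t) * b ^ 2)) := by
  have hk := H.khat_nonneg ht
  have h2 : 0 ≤ M.ω (1 - t) := by rw [← H.wt_sq t ⟨ht.1, ht.2.le⟩]; positivity
  rw [khatExt, if_pos ht.2, ← ENNReal.ofReal_mul hk, ← ENNReal.ofReal_add (by positivity)
    (by positivity), ENNReal.ofReal_rpow_half (by positivity)]

/-- The calibration inequality. -/
theorem le_density (H : M.Regular) {m l t : ℝ} (p b : ℝ) (hm : m ∈ Ico (0 : ℝ) 1)
    (hl : l ^ 2 ≤ M.khat m) (ht : t ∈ Icc m 1) :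
    ENNReal.ofReal (l * p + M.slack l t * |b|) ≤
      (M.khatExt t * ENNReal.ofReal (p ^ 2) +
        ENNReal.ofReal (M.ω (1 - t) * b ^ 2)) ^ (1 / 2 : ℝ) := by
  rcases ht.2.eq_or_lt with rfl | h
  · have h0 : M.slack l 1 = 0 := by simp [slack, H.wt_one]
    have h1 : ENNReal.ofReal (l * p) ≤ ENNReal.ofReal (M.khat m * p ^ 2) ^ (1 / 2 : ℝ) := by
      rw [ENNReal.ofReal_rpow_half (mul_nonneg (H.khat_nonneg hm) (sq_nonneg p))]
      refine ENNReal.ofReal_le_ofReal (Real.le_sqrt_of_sq_le ?_)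
      rw [mul_pow]
      exact mul_le_mul_of_nonneg_right hl (sq_nonneg p)
    rw [h0, zero_mul, add_zero]
    refine h1.trans (ENNReal.rpow_le_rpow (le_add_right ?_) (by norm_num))
    rw [ENNReal.ofReal_mul (H.khat_nonneg hm), khatExt, if_neg (lt_irrefl 1)]
    gcongr
    exact H.ofReal_khat_le hm
  · have ht' : t ∈ Ico (0 : ℝ) 1 := ⟨hm.1.trans ht.1, h⟩
    rw [H.density_eq p b ht', ← H.wt_sq t ⟨ht'.1, ht'.2.le⟩]
    refine ENNReal.ofReal_le_ofReal (Real.le_sqrt_of_sq_le ?_)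
    have hlk := hl.trans (H.khat_mono hm.1 ht.1 h)
    have hk := H.khat_nonneg ht'
    rw [slack]
    obtain ⟨w, hw, hw2⟩ : ∃ w, w = Real.sqrt (1 - l ^ 2 / M.khat t) ∧
        M.khat t * w ^ 2 = M.khat t - l ^ 2 := by
      refine ⟨_, rfl, ?_⟩
      rcases hk.eq_or_lt with h0 | h0
      · rw [← h0] at hlk ⊢
        nlinarith [sq_nonneg l]
      · rw [Real.sq_sqrt (by rw [sub_nonneg, div_le_one h0]; exact hlk)]
        field_simp
    have hw1 : w ^ 2 ≤ 1 := by
      have : w ≤ 1 := by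
        rw [hw, Real.sqrt_le_one]
        have := div_nonneg (sq_nonneg l) hk
        linarith
      have : 0 ≤ w := hw ▸ Real.sqrt_nonneg _
      nlinarith
    rw [← hw, ← sq_abs b, ← sub_nonneg]
    set c := |b|
    rcases hk.eq_or_lt with h0 | h0
    · have : l = 0 := by
        rw [← h0] at hlk
        exact pow_eq_zero_iff two_ne_zero |>.1 (le_antisymm hlk (sq_nonneg l))
      rw [← h0, this]
      nlinarith [mul_nonneg (sq_nonneg (M.wt t * c)) (sub_nonneg.2 hw1)]
    · refine nonneg_of_mul_nonneg_right (a := M.khat t) ?_ h0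
      -- The defect in the Cauchy–Schwarz inequality, multiplied by khat, is a perfect square.
      have : M.khat t * (M.khat t * p ^ 2 + M.wt t ^ 2 * c ^ 2 -
          (l * p + M.wt t * w * c) ^ 2) = (M.khat t * w * p - M.wt t * c * l) ^ 2 := by
        linear_combination (-(M.khat t * p ^ 2) - M.wt t ^ 2 * c ^ 2) * hw2
      rw [this]
      positivity

end Regular
end CohesiveFracture.Model

/-! ### Lower bounds for curves and for graphs -/

theorem LipschitzWith.comp_absolutelyContinuousOnInterval {P f : ℝ → ℝ} {K : ℝ≥0} {a b : ℝ}
    (hP : LipschitzWith K P) (hf : AbsolutelyContinuousOnInterval f a b) :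
    AbsolutelyContinuousOnInterval (fun x => P (f x)) a b := by
  refine squeeze_zero (fun E => Finset.sum_nonneg fun i _ => dist_nonneg) (fun E => ?_)
    (by simpa using Tendsto.const_mul (K : ℝ) hf)
  rw [Finset.mul_sum]
  exact Finset.sum_le_sum fun i _ => hP.dist_le_mul _ _

theorem AbsolutelyContinuousOnInterval.sub_le_integral_abs_deriv {f : ℝ → ℝ} {a b : ℝ}
    (hab : a ≤ b) (hf : AbsolutelyContinuousOnInterval f a b) :
    |f b - f a| ≤ ∫ x in a..b, |deriv f x| := by
  rw [← hf.integral_deriv_eq_sub]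
  exact intervalIntegral.abs_integral_le_integral_abs hab

namespace CohesiveFracture.Model.Regular

variable {M : Model}

/-- Let P be a primitive of `slack l`. Then P∘β goes from P(1) to P(β x₀) and back to P(1), and each
way costs at least the integral of `slack` over [β x₀, 1]; hence the factor 2 in `dual`. The
interval [c,d] is arbitrary so as to serve both pairs on [0,1] and graphs on [2m-1,1]. -/
theorem le_lintegral_density (H : M.Regular) {m l c d x₀ : ℝ} {γ β : ℝ → ℝ}
    (hm : m ∈ Ico (0 : ℝ) 1) (hl0 : 0 ≤ l) (hl : l ^ 2 ≤ M.khat m) (hcd : c ≤ d)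
    (hγ : AbsolutelyContinuousOnInterval γ c d) (hβ : AbsolutelyContinuousOnInterval β c d)
    (hβm : ∀ x ∈ Icc c d, β x ∈ Icc m 1) (hβc : β c = 1) (hβd : β d = 1) (hx₀ : x₀ ∈ Icc c d) :
    ENNReal.ofReal (M.dual (γ d - γ c) (β x₀) l) ≤
      ∫⁻ x in Ioo c d, (M.khatExt (β x) * ENNReal.ofReal ((deriv γ x) ^ 2) +
        ENNReal.ofReal (M.ω (1 - β x) * (deriv β x) ^ 2)) ^ (1 / 2 : ℝ) := by
  -- Extending `slack` by constants makes P Lipschitz and differentiable on the whole line, so P∘β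
  -- is absolutely continuous and the chain rule holds wherever β is differentiable.
  set h : ℝ → ℝ := IccExtend hm.2.le ((Icc m 1).domRestrict (M.slack l)) with hh
  have hcont : Continuous h :=
    (continuousOn_iff_continuous_domRestrict.1 (H.continuousOn_slack hm hl)).Icc_extend'
  have hslack : ∀ t ∈ Icc m 1, h t = M.slack l t := fun t ht => by
    rw [hh, IccExtend_of_mem hm.2.le _ ht, domRestrict_apply]
  have hh0 : ∀ t, 0 ≤ h t := fun t => M.slack_nonneg _ _
  obtain ⟨C, hC⟩ := isCompact_Icc.exists_bound_of_continuousOn (H.continuousOn_slack hm hl)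
  have hhC : ∀ t, ‖h t‖ ≤ C := fun t => hC _ (projIcc m 1 hm.2.le t).2
  set P : ℝ → ℝ := fun y => ∫ t in m..y, h t with hP
  have hPd : ∀ y, HasDerivAt P (h y) y := fun y => hcont.integral_hasStrictDerivAt m y |>.hasDerivAt
  have hPL : LipschitzWith ⟨C, (norm_nonneg _).trans (hhC 0)⟩ P :=
    lipschitzWith_of_nnnorm_deriv_le (fun y => (hPd y).differentiableAt) fun y => by
      rw [(hPd y).deriv]; exact hhC y
  have hV := hPL.comp_absolutelyContinuousOnInterval hβ
  set V : ℝ → ℝ := fun x => P (β x) with hVdef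
  have hPsub : P 1 - P (β x₀) = ∫ t in β x₀..1, M.slack l t := by
    have hb := hβm x₀ hx₀
    rw [hP, intervalIntegral.integral_interval_sub_left (hcont.intervalIntegrable _ _)
      (hcont.intervalIntegrable _ _)]
    refine intervalIntegral.integral_congr fun t ht => hslack t ?_
    rw [uIcc_of_le hb.2] at ht
    exact ⟨hb.1.trans ht.1, ht.2⟩
  have h1 := hV.mono (c := c) (d := x₀) (by
    rw [uIcc_of_le hx₀.1, uIcc_of_le hcd]; exact Icc_subset_Icc_right hx₀.2)
  have h2 := hV.mono (c := x₀) (d := d) (by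
    rw [uIcc_of_le hx₀.2, uIcc_of_le hcd]; exact Icc_subset_Icc_left hx₀.1)
  have e0 : γ d - γ c ≤ ∫ x in c..d, |deriv γ x| :=
    (le_abs_self _).trans (hγ.sub_le_integral_abs_deriv hcd)
  have e1 : P 1 - P (β x₀) ≤ ∫ x in c..x₀, |deriv V x| := by
    refine le_trans ?_ (h1.sub_le_integral_abs_deriv hx₀.1)
    rw [hVdef]
    simp only [hβc]
    rw [abs_sub_comm]
    exact le_abs_self _
  have e2 : P 1 - P (β x₀) ≤ ∫ x in x₀..d, |deriv V x| := by
    refine le_trans ?_ (h2.sub_le_integral_abs_deriv hx₀.2)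
    rw [hVdef]
    simp only [hβd]
    exact le_abs_self _
  have iV := hV.intervalIntegrable_deriv.abs
  have iγ := hγ.intervalIntegrable_deriv.abs
  have e3 := intervalIntegral.integral_add_adjacent_intervals h1.intervalIntegrable_deriv.abs
    h2.intervalIntegrable_deriv.abs
  have iR : IntervalIntegrable (fun x => l * |deriv γ x| + |deriv V x|) volume c d :=
    (iγ.const_mul l).add iV
  have e4 : M.dual (γ d - γ c) (β x₀) l ≤ ∫ x in c..d, (l * |deriv γ x| + |deriv V x|) := by
    rw [intervalIntegral.integral_add (iγ.const_mul l) iV, intervalIntegral.integral_const_mul,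
      dual, ← hPsub, ← e3]
    have := mul_le_mul_of_nonneg_left e0 hl0
    linarith
  refine (ENNReal.ofReal_le_ofReal e4).trans ?_
  rw [intervalIntegral.integral_of_le hcd, integral_Ioc_eq_integral_Ioo,
    ofReal_integral_eq_lintegral_ofReal]
  · refine lintegral_mono_ae ((ae_restrict_iff' measurableSet_Ioo).2 ?_)
    filter_upwards [hβ.ae_differentiableAt] with x hx hxcd
    have hxI : x ∈ Icc c d := ⟨hxcd.1.le, hxcd.2.le⟩
    have hd : deriv V x = h (β x) * deriv β x :=
      ((hPd (β x)).comp x (hx (by rwa [uIcc_of_le hcd])).hasDerivAt).deriv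
    have hb := hβm x hxI
    have := H.le_density |deriv γ x| (deriv β x) hm hl hb
    rw [sq_abs] at this
    rwa [hd, abs_mul, abs_of_nonneg (hh0 _), hslack _ hb]
  · exact ((intervalIntegrable_iff_integrableOn_Ioc_of_le hcd).1 iR).mono_set Ioo_subset_Ioc_self
  · exact Eventually.of_forall fun x => by positivity

/-- Every admissible pair has energy at least `l s`, if `β` is so large that the slope `l` is
admissible, and at least `dual s m l`, if moreover `m` is a value of `β`. -/
theorem le_energy (H : M.Regular) {m l s x₀ : ℝ} {γ β : ℝ → ℝ} (hm : m ∈ Ico (0 : ℝ) 1)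
    (hl0 : 0 ≤ l) (hl : l ^ 2 ≤ M.khat m) (hp : (γ, β) ∈ admissible s)
    (hβm : ∀ x ∈ Icc (0 : ℝ) 1, m ≤ β x) (hx₀ : x₀ ∈ Icc (0 : ℝ) 1) :
    ENNReal.ofReal (M.dual s (β x₀) l) ≤ M.energy γ β := by
  obtain ⟨hγ, hβ, hγ0, hγ1, hβI, hβ0, hβ1⟩ := hp
  have := H.le_lintegral_density hm hl0 hl zero_le_one hγ.1 hβ.1
    (fun x hx => ⟨hβm x hx, (hβI x hx).2⟩) hβ0 hβ1 hx₀
  simp only at hγ0 hγ1 this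
  rw [hγ0, hγ1, sub_zero] at this
  simpa [energy, H.phiPrime_eq] using this

/-- The lower bound for graphs. -/
theorem le_Gm (H : M.Regular) {m l s : ℝ} {u : ℝ → ℝ} (hm : m ∈ Ioo (0 : ℝ) 1)
    (hl0 : 0 ≤ l) (hl : l ^ 2 ≤ M.khat m) (hu : AbsolutelyContinuousOnInterval u (2 * m - 1) 1)
    (hu0 : u (2 * m - 1) = 0) (hu1 : u 1 = s) :
    ENNReal.ofReal (M.dual s m l) ≤ M.Gm m u := by
  -- A graph is a curve with the prescribed height m + |t - m|, whose derivative has square 1 away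
  -- from t = m.
  have hβL : LipschitzWith 1 fun t : ℝ => m + |t - m| := LipschitzWith.of_dist_le_mul fun x y => by
    rw [Real.dist_eq, Real.dist_eq, NNReal.coe_one, one_mul, add_sub_add_left_eq_sub]
    simpa using abs_abs_sub_abs_le_abs_sub (x - m) (y - m)
  have := H.le_lintegral_density (x₀ := m) (c := 2 * m - 1) (d := 1) ⟨hm.1.le, hm.2⟩ hl0 hl
    (by linarith [hm.2]) hu hβL.lipschitzOnWith.absolutelyContinuousOnInterval
    (fun x hx => ⟨by simp, by
      have : |x - m| ≤ 1 - m := abs_le.2 ⟨by linarith [hx.1], by linarith [hx.2]⟩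
      linarith⟩)
    (by rw [abs_of_neg] <;> linarith [hm.2]) (by rw [abs_of_pos] <;> linarith [hm.2])
    ⟨by linarith [hm.2], hm.2.le⟩
  simp only [hu0, hu1, sub_self, abs_zero, add_zero, sub_zero] at this
  refine this.trans (le_of_eq ?_)
  refine lintegral_congr_ae (ae_restrict_of_ae ?_)
  have hne : ∀ᵐ x : ℝ, x ≠ m := by simp [ae_iff, measure_singleton]
  filter_upwards [hne] with x hx
  have hd : deriv (fun t : ℝ => m + |t - m|) x ^ 2 = 1 := by
    rw [deriv_const_add]
    have h0 : x - m ≠ 0 := sub_ne_zero.2 hx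
    have := (hasDerivAt_abs h0).comp_sub_const x m
    rw [this.deriv]
    rcases lt_or_gt_of_ne h0 with h | h <;> simp [h]
  rw [hd, mul_one]

end CohesiveFracture.Model.Regular

/-! ### Upper bounds from competitors -/

namespace CohesiveFracture

theorem memH1_of_lipschitzWith {u : ℝ → ℝ} {K : ℝ≥0} (hu : LipschitzWith K u) : MemH1 u :=
  ⟨hu.lipschitzOnWith.absolutelyContinuousOnInterval,
    MemLp.of_bound (measurable_deriv u).aestronglyMeasurable K
      (Eventually.of_forall fun _ => norm_deriv_le_of_lipschitz hu)⟩

/-- Relaxation does not change the infimum: the envelope lies below F, and, constants being lower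
semicontinuous, it lies above every constant lower bound of F. -/
theorem iInf_lscEnvelope_le {X : Type*} [TopologicalSpace X] (F : X → ℝ≥0∞) (x : X) :
    ⨅ y, lscEnvelope F y ≤ F x :=
  (iInf_le _ x).trans (iSup₂_le fun _ _ => iSup_le fun hG => hG x)

theorem le_iInf_lscEnvelope {X : Type*} [TopologicalSpace X] {F : X → ℝ≥0∞} {c : ℝ≥0∞}
    (h : ∀ x, c ≤ F x) : c ≤ ⨅ y, lscEnvelope F y :=
  le_iInf fun _ => le_iSup_of_le (fun _ => c)
    (le_iSup_of_le lowerSemicontinuous_const (le_iSup_of_le h le_rfl))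

/-- Reflection in `m` onto `[m,1]`. -/
noncomputable def fold (m t : ℝ) : ℝ := min (m + |t - m|) 1

theorem continuous_fold (m : ℝ) : Continuous (fold m) := by unfold fold; fun_prop

theorem fold_mem {m : ℝ} (hm : m ≤ 1) (t : ℝ) : fold m t ∈ Icc m 1 :=
  ⟨le_min (by simp) hm, min_le_right _ _⟩

/-- The truncation at 1 in `fold` keeps its values in [m,1], so continuity on [m,1] is enough for
continuity on the whole line. -/
theorem continuous_comp_fold {f : ℝ → ℝ} {m : ℝ} (hm : m ≤ 1) (hf : ContinuousOn f (Icc m 1)) :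
    Continuous fun t => f (fold m t) :=
  hf.comp_continuous (continuous_fold m) (fold_mem hm)

theorem fold_eq {m t : ℝ} (ht : t ∈ Icc (2 * m - 1) 1) : fold m t = m + |t - m| := by
  refine min_eq_left ?_
  have : |t - m| ≤ 1 - m := abs_le.2 ⟨by linarith [ht.1], by linarith [ht.2]⟩
  linarith

theorem integral_comp_fold {f : ℝ → ℝ} {m : ℝ} (hm : m ≤ 1) (hf : ContinuousOn f (Icc m 1)) :
    ∫ t in (2 * m - 1)..1, f (fold m t) = 2 * ∫ t in m..1, f t := by
  have hc := continuous_comp_fold hm hf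
  rw [← intervalIntegral.integral_add_adjacent_intervals (b := m) (hc.intervalIntegrable _ _)
    (hc.intervalIntegrable _ _)]
  have e1 : ∫ t in m..1, f (fold m t) = ∫ t in m..1, f t := by
    refine intervalIntegral.integral_congr fun t ht => ?_
    rw [uIcc_of_le hm] at ht
    rw [fold_eq ⟨by linarith [ht.1], ht.2⟩, abs_of_nonneg (by linarith [ht.1])]
    congr 1; ring
  have e2 : ∫ t in (2 * m - 1)..m, f (fold m t) = ∫ t in m..1, f (fold m t) := by
    have := intervalIntegral.integral_comp_sub_left (a := m) (b := 1)
      (fun t => f (fold m t)) (2 * m)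
    rw [show 2 * m - m = m by ring] at this
    rw [← this]
    congr 1
    ext t
    simp only [fold]
    rw [show 2 * m - t - m = -(t - m) by ring, abs_neg]
  rw [e2, e1]; ring

namespace Model

variable {M : Model}

/-- `q` is the slope of a competitor with displacement `s` in the minimum problems for `g(s)` and
`𝔊_s(m)`, and `R` bounds its energy density. -/
structure IsCompetitor (M : Model) (m s : ℝ) (q R : ℝ → ℝ) : Prop where
  continuous_slope : Continuous q
  bounded_slope : ∃ K, ∀ t, ‖q t‖ ≤ K
  integral_slope : ∫ t in (2 * m - 1)..1, q t = s
  continuous_density : Continuous R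
  density_le : ∀ t ∈ Ioo (2 * m - 1) 1,
    Real.sqrt (M.khat (m + |t - m|) * q t ^ 2 + M.ω (1 - (m + |t - m|))) ≤ R t

namespace IsCompetitor

variable {m s : ℝ} {q R : ℝ → ℝ}

theorem hasDerivAt (h : M.IsCompetitor m s q R) (t : ℝ) :
    HasDerivAt (fun y => ∫ x in (2 * m - 1)..y, q x) (q t) t :=
  (h.continuous_slope.integral_hasStrictDerivAt (2 * m - 1) t).hasDerivAt

theorem exists_lipschitzWith (h : M.IsCompetitor m s q R) :
    ∃ K, LipschitzWith K fun y => ∫ x in (2 * m - 1)..y, q x := by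
  obtain ⟨K, hK⟩ := h.bounded_slope
  refine ⟨⟨K, (norm_nonneg _).trans (hK 0)⟩, lipschitzWith_of_nnnorm_deriv_le
    (fun y => (h.hasDerivAt y).differentiableAt) fun y => ?_⟩
  rw [(h.hasDerivAt y).deriv]
  exact hK y

theorem _root_.lintegral_ofReal_Ioo {f : ℝ → ℝ} {a b : ℝ} (hab : a ≤ b) (hf : Continuous f)
    (h0 : ∀ t ∈ Ioo a b, 0 ≤ f t) :
    ∫⁻ t in Ioo a b, ENNReal.ofReal (f t) = ENNReal.ofReal (∫ t in a..b, f t) := by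
  rw [intervalIntegral.integral_of_le hab, integral_Ioc_eq_integral_Ioo,
    ofReal_integral_eq_lintegral_ofReal]
  · exact ((intervalIntegrable_iff_integrableOn_Ioc_of_le hab).1
      (hf.intervalIntegrable a b)).mono_set Ioo_subset_Ioc_self
  · exact (ae_restrict_iff' measurableSet_Ioo).2 (Eventually.of_forall h0)

theorem height_mem (hm : m ∈ Ioo (0 : ℝ) 1) {t : ℝ} (ht : t ∈ Ioo (2 * m - 1) 1) :
    m + |t - m| ∈ Ico (0 : ℝ) 1 := by
  have : |t - m| < 1 - m := abs_lt.2 ⟨by linarith [ht.1], by linarith [ht.2]⟩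
  exact ⟨add_nonneg hm.1.le (abs_nonneg _), by linarith⟩

theorem frakG_le (h : M.IsCompetitor m s q R) (H : M.Regular) (hm : m ∈ Ioo (0 : ℝ) 1) :
    M.frakG s m ≤ ENNReal.ofReal (∫ t in (2 * m - 1)..1, R t) := by
  set u : ℝ → ℝ := fun y => ∫ x in (2 * m - 1)..y, q x with hu
  obtain ⟨K, hK⟩ := h.exists_lipschitzWith
  have hmL : MemLp u 1 (volume.restrict (Ioo (2 * m - 1) 1)) := by
    rw [memLp_one_iff_integrable]
    exact (hK.continuous.integrableOn_Icc).mono_set Ioo_subset_Icc_self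
  refine (iInf_lscEnvelope_le _ (hmL.toLp u)).trans ?_
  refine (iInf_le_of_le u (iInf₂_le_of_le hK.lipschitzOnWith.absolutelyContinuousOnInterval
    (by simp [hu]) (iInf₂_le_of_le (by simpa [hu] using h.integral_slope)
    hmL.coeFn_toLp le_rfl))).trans ?_
  rw [← lintegral_ofReal_Ioo (by linarith [hm.2]) h.continuous_density
    fun t ht => (Real.sqrt_nonneg _).trans (h.density_le t ht)]
  refine setLIntegral_mono' measurableSet_Ioo fun t ht => ?_
  have hd := H.density_eq (deriv u t) 1 (height_mem hm ht)
  simp only [one_pow, mul_one] at hd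
  rw [hd, (h.hasDerivAt t).deriv]
  exact ENNReal.ofReal_le_ofReal (h.density_le t ht)

/-- The energy density is 1-homogeneous in the derivatives, so an affine reparametrization of
[2m-1,1] by [0,1] turns the graph into an admissible pair of the same energy. -/
theorem g_le (h : M.IsCompetitor m s q R) (H : M.Regular) (hm : m ∈ Ioo (0 : ℝ) 1) :
    M.g s ≤ ENNReal.ofReal (∫ t in (2 * m - 1)..1, R t) := by
  set u : ℝ → ℝ := fun y => ∫ x in (2 * m - 1)..y, q x with hu
  obtain ⟨K, hK⟩ := h.exists_lipschitzWith
  set c : ℝ := 2 * (1 - m) with hc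
  have hc0 : 0 < c := by rw [hc]; linarith [hm.2]
  set T : ℝ → ℝ := fun x => c * x + (2 * m - 1) with hT
  have hTm : ∀ x ∈ Ioo (0 : ℝ) 1, T x ∈ Ioo (2 * m - 1) 1 := fun x hx =>
    ⟨by rw [hT]; nlinarith [hx.1], by simp only [hT, hc]; nlinarith [hx.2, hm.2]⟩
  have hTd : ∀ x, HasDerivAt T c x := fun x => by
    have := ((hasDerivAt_id x).const_mul c).add_const (2 * m - 1)
    rwa [mul_one] at this
  have hTL : LipschitzWith ‖c‖₊ T := lipschitzWith_of_nnnorm_deriv_le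
    (fun x => (hTd x).differentiableAt) fun x => by rw [(hTd x).deriv]
  have hβL : LipschitzWith 1 fun t : ℝ => m + |t - m| := LipschitzWith.of_dist_le_mul fun x y => by
    rw [Real.dist_eq, Real.dist_eq, NNReal.coe_one, one_mul, add_sub_add_left_eq_sub]
    simpa using abs_abs_sub_abs_le_abs_sub (x - m) (y - m)
  have hT0 : T 0 = 2 * m - 1 := by simp [hT]
  have hT1 : T 1 = 1 := by simp only [hT, hc]; ring
  have hadm : (u ∘ T, (fun t : ℝ => m + |t - m|) ∘ T) ∈ admissible s := by
    refine ⟨memH1_of_lipschitzWith (hK.comp hTL), memH1_of_lipschitzWith (hβL.comp hTL), ?_, ?_,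
      fun x hx => ⟨add_nonneg hm.1.le (abs_nonneg _), ?_⟩, ?_, ?_⟩
    · simp [hT0, hu]
    · simpa [hT1, hu] using h.integral_slope
    · have : |T x - m| ≤ 1 - m := abs_le.2
        ⟨by simp only [hT, hc]; nlinarith [hx.1, hm.2], by simp only [hT, hc]; nlinarith [hx.2, hm.2]⟩
      simp only [Function.comp]
      linarith
    · simp only [Function.comp, hT0]
      rw [abs_of_neg] <;> linarith [hm.2]
    · simp only [Function.comp, hT1]
      rw [abs_of_pos] <;> linarith [hm.2]
  refine (iInf₂_le _ hadm).trans ?_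
  have hint : ∫ t in (2 * m - 1)..1, R t = ∫ x in (0 : ℝ)..1, c * R (T x) := by
    rw [intervalIntegral.integral_const_mul, hT]
    simp only
    rw [intervalIntegral.integral_comp_mul_add R hc0.ne', smul_eq_mul, ← mul_assoc,
      mul_inv_cancel₀ hc0.ne', one_mul]
    congr 1
    · ring
    · rw [hc]; ring
  have hRnn : ∀ x ∈ Ioo (0 : ℝ) 1, 0 ≤ R (T x) := fun x hx =>
    (Real.sqrt_nonneg _).trans (h.density_le _ (hTm x hx))
  have hRc := h.continuous_density
  have hTc := hTL.continuous
  rw [hint, ← lintegral_ofReal_Ioo zero_le_one (by fun_prop)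
    fun t ht => mul_nonneg hc0.le (hRnn t ht), energy, H.phiPrime_eq]
  refine lintegral_mono_ae ((ae_restrict_iff' measurableSet_Ioo).2 ?_)
  -- The height has its kink at x = 1/2, the point which T sends to m.
  have hne : ∀ᵐ x : ℝ, x ≠ 1 / 2 := by simp [ae_iff, measure_singleton]
  filter_upwards [hne] with x hx hx01
  have hTx : T x - m ≠ 0 := by
    have : T x - m = c * (x - 1 / 2) := by simp only [hT, hc]; ring
    rw [this]
    exact mul_ne_zero hc0.ne' (sub_ne_zero.2 hx)
  have hγd : deriv (u ∘ T) x = q (T x) * c :=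
    ((h.hasDerivAt (T x)).comp x (hTd x)).deriv
  have hβd : deriv ((fun t : ℝ => m + |t - m|) ∘ T) x ^ 2 = c ^ 2 := by
    have := ((hasDerivAt_abs hTx).comp x ((hTd x).sub_const m)).const_add m
    have hd : deriv ((fun t : ℝ => m + |t - m|) ∘ T) x = _ := this.deriv
    rw [hd]
    rcases lt_or_gt_of_ne hTx with h | h <;> simp [h]
  simp only [ENNReal.ofReal_one, one_mul]
  rw [hγd, hβd]
  simp only [Function.comp]
  rw [H.density_eq (q (T x) * c) c (height_mem hm (hTm x hx01))]
  refine ENNReal.ofReal_le_ofReal ?_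
  have := h.density_le _ (hTm x hx01)
  calc _ = Real.sqrt (c ^ 2 * (M.khat (m + |T x - m|) * q (T x) ^ 2 +
        M.ω (1 - (m + |T x - m|)))) := by congr 1; ring
    _ = c * _ := by rw [Real.sqrt_mul (sq_nonneg c), Real.sqrt_sq hc0.le]
    _ ≤ _ := mul_le_mul_of_nonneg_left this hc0.le

end IsCompetitor
end Model
end CohesiveFracture

/-! ### Nearly optimal competitors at a given height -/

namespace CohesiveFracture.Model.Regular

variable {M : Model}

theorem slope_one (H : M.Regular) (l : ℝ) : M.slope l 1 = 0 := by
  have := H.wt_sq 1 ⟨zero_le_one, le_rfl⟩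
  rw [H.wt_one, sub_self] at this
  rw [slope, sub_self, ← this]
  simp

theorem slope_le_wt (H : M.Regular) {m l t : ℝ} (hm : m ∈ Ico (0 : ℝ) 1) (hl : l ^ 2 < M.khat m)
    (ht : t ∈ Icc m 1) :
    M.slope l t ≤ Real.sqrt (l ^ 2 / (M.khat m * (M.khat m - l ^ 2))) * M.wt t := by
  rcases ht.2.eq_or_lt with rfl | h
  · rw [H.slope_one, H.wt_one, mul_zero]
  have hk : 0 < M.khat m := lt_of_le_of_lt (sq_nonneg l) hl
  have hkt := H.khat_mono hm.1 ht.1 h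
  have h1 : 0 < M.khat m - l ^ 2 := sub_pos.2 hl
  rw [wt, ← Real.sqrt_mul (by positivity)]
  refine Real.sqrt_le_sqrt ?_
  have h2 : 0 ≤ M.ω (1 - t) := by rw [← H.wt_sq t ⟨hm.1.trans ht.1, ht.2⟩]; positivity
  have hkt0 := hk.le.trans hkt
  rw [div_mul_eq_mul_div]
  gcongr

theorem slope_mono (H : M.Regular) {l l' t : ℝ} (ht : t ∈ Ico (0 : ℝ) 1) (hl0 : 0 ≤ l)
    (hll : l ≤ l') (hl : l' ^ 2 < M.khat t) : M.slope l t ≤ M.slope l' t := by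
  have hk : 0 < M.khat t := lt_of_le_of_lt (sq_nonneg l') hl
  have h2 : 0 ≤ M.ω (1 - t) := by rw [← H.wt_sq t ⟨ht.1, ht.2.le⟩]; positivity
  have h1 : 0 < M.khat t - l' ^ 2 := sub_pos.2 hl
  refine Real.sqrt_le_sqrt ?_
  gcongr

theorem continuousWithinAt_khat (H : M.Regular) {m t : ℝ} (hm : 0 ≤ m) (ht : t ∈ Ico m 1) :
    ContinuousWithinAt M.khat (Icc m 1) t :=
  (H.continuousOn_khat t ⟨hm.trans ht.1, ht.2⟩).mono_of_mem_nhdsWithin (by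
    filter_upwards [self_mem_nhdsWithin, mem_nhdsWithin_of_mem_nhds (Iio_mem_nhds ht.2)]
      with x hx hx' using ⟨hm.trans hx.1, hx'⟩)

theorem continuousOn_slope (H : M.Regular) {m l : ℝ} (hm : m ∈ Ico (0 : ℝ) 1)
    (hl : l ^ 2 < M.khat m) : ContinuousOn (M.slope l) (Icc m 1) := by
  intro t ht
  have hw := H.continuousOn_wt.mono (Icc_subset_Icc_left hm.1) t ht
  rcases ht.2.eq_or_lt with rfl | h
  · rw [ContinuousWithinAt, H.wt_one] at hw
    rw [ContinuousWithinAt, H.slope_one]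
    have := hw.const_mul (Real.sqrt (l ^ 2 / (M.khat m * (M.khat m - l ^ 2))))
    rw [mul_zero] at this
    refine tendsto_of_tendsto_of_tendsto_of_le_of_le' tendsto_const_nhds this
      (Eventually.of_forall fun x => M.slope_nonneg l x) ?_
    filter_upwards [self_mem_nhdsWithin] with x hx using H.slope_le_wt hm hl hx
  · have hkt := H.khat_mono hm.1 ht.1 h
    have hk : 0 < M.khat m := lt_of_le_of_lt (sq_nonneg l) hl
    have hc := H.continuousWithinAt_khat hm.1 ⟨ht.1, h⟩
    refine ContinuousWithinAt.congr (f := fun t =>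
      Real.sqrt (l ^ 2 * M.wt t ^ 2 / (M.khat t * (M.khat t - l ^ 2)))) ?_
      (fun x hx => by rw [slope, H.wt_sq x ⟨hm.1.trans hx.1, hx.2⟩])
      (by rw [slope, H.wt_sq t ⟨hm.1.trans ht.1, ht.2⟩])
    refine Real.continuous_sqrt.continuousAt.comp_continuousWithinAt
      (((hw.pow 2).const_mul _).div (hc.mul (hc.sub continuousWithinAt_const)) ?_)
    exact (mul_pos (by linarith) (by linarith)).ne'

theorem intervalIntegrable_slope (H : M.Regular) {m l : ℝ} (hm : m ∈ Ico (0 : ℝ) 1)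
    (hl : l ^ 2 < M.khat m) : IntervalIntegrable (M.slope l) volume m 1 :=
  ((H.continuousOn_slope hm hl).mono (uIcc_of_le hm.2.le).subset).intervalIntegrable

/-- Dominated convergence, with the largest slope as bound. Together with the intermediate value
theorem it allows the displacement of the geodesic to be prescribed. -/
theorem continuousOn_integral_slope (H : M.Regular) {m l : ℝ} (hm : m ∈ Ico (0 : ℝ) 1)
    (hl : l ^ 2 < M.khat m) :
    ContinuousOn (fun x => ∫ t in m..1, M.slope x t) (Icc 0 l) := by
  intro x₀ hx₀
  have hsq : ∀ x ∈ Icc 0 l, x ^ 2 < M.khat m := fun x hx =>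
    (pow_le_pow_left₀ hx.1 hx.2 2).trans_lt hl
  have hne : ∀ᵐ t : ℝ, t ≠ 1 := by simp [ae_iff, measure_singleton]
  refine intervalIntegral.continuousWithinAt_of_dominated_interval (bound := M.slope l) ?_ ?_
    (H.intervalIntegrable_slope hm hl) ?_
  · filter_upwards [self_mem_nhdsWithin] with x hx
    exact (H.intervalIntegrable_slope hm (hsq x hx)).aestronglyMeasurable_restrict_uIoc
  · filter_upwards [self_mem_nhdsWithin] with x hx
    filter_upwards [hne] with t ht htI
    rw [uIoc_of_le hm.2.le] at htI
    have h1 := lt_of_le_of_ne htI.2 ht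
    rw [Real.norm_of_nonneg (M.slope_nonneg x t)]
    exact H.slope_mono ⟨hm.1.trans htI.1.le, h1⟩ hx.1 hx.2
      (hl.trans_le (H.khat_mono hm.1 htI.1.le h1))
  · filter_upwards [hne] with t ht htI
    rw [uIoc_of_le hm.2.le] at htI
    have hkt := H.khat_mono hm.1 htI.1.le (lt_of_le_of_ne htI.2 ht)
    have hx := hsq x₀ hx₀
    have hk : 0 < M.khat m := lt_of_le_of_lt (sq_nonneg l) hl
    refine ContinuousAt.continuousWithinAt (Real.continuous_sqrt.continuousAt.comp ?_)
    refine ContinuousAt.div (by fun_prop) (by fun_prop) ?_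
    exact (mul_pos (by linarith) (by linarith)).ne'

/-- The ramp carries half of the displacement r, since folding doubles it, and it is supported in
heights at most y, which will be close to m. -/
theorem integral_hat {m y r : ℝ} (hmy : m < y) (hy : y ≤ 1) :
    ∫ t in m..1, r / (y - m) ^ 2 * max 0 (y - t) = r / 2 := by
  have hc : Continuous fun t : ℝ => r / (y - m) ^ 2 * max 0 (y - t) := by fun_prop
  rw [← intervalIntegral.integral_add_adjacent_intervals (b := y) (hc.intervalIntegrable _ _)
    (hc.intervalIntegrable _ _)]
  have e1 : ∫ t in m..y, r / (y - m) ^ 2 * max 0 (y - t) =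
      ∫ t in m..y, r / (y - m) ^ 2 * (y - t) :=
    intervalIntegral.integral_congr fun t ht => by
      rw [uIcc_of_le hmy.le] at ht
      rw [max_eq_right (by linarith [ht.2])]
  have e2 : ∫ t in y..1, r / (y - m) ^ 2 * max 0 (y - t) = ∫ _ in y..1, (0 : ℝ) :=
    intervalIntegral.integral_congr fun t ht => by
      rw [uIcc_of_le hy] at ht
      rw [max_eq_left (by linarith [ht.1]), mul_zero]
  have hne : y - m ≠ 0 := (sub_pos.2 hmy).ne'
  rw [e1, e2, intervalIntegral.integral_const_mul, intervalIntegral.integral_sub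
    (by simp) (by simp), integral_id, intervalIntegral.integral_const, intervalIntegral.integral_zero,
    smul_eq_mul]
  field_simp
  ring

/-- The geodesic of Clairaut constant l covers only b = 2∫`slope`. The missing s - b is inserted at
heights just above m, at a price of about √khat(m) per unit instead of the l already counted in
`dual`; this explains the term (√khat(m) - l)(s - b). -/
theorem exists_isCompetitor (H : M.Regular) {m l s ε : ℝ} (hm : m ∈ Ioo (0 : ℝ) 1) (hl0 : 0 ≤ l)
    (hl : l ^ 2 < M.khat m) (hs : 2 * ∫ t in m..1, M.slope l t ≤ s) (hε : 0 < ε) :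
    ∃ q R, M.IsCompetitor m s q R ∧ ∫ t in (2 * m - 1)..1, R t ≤ M.dual s m l +
      (Real.sqrt (M.khat m) - l) * (s - 2 * ∫ t in m..1, M.slope l t) + ε := by
  have hm' : m ∈ Ico (0 : ℝ) 1 := ⟨hm.1.le, hm.2⟩
  set b := 2 * ∫ t in m..1, M.slope l t with hb
  have hr : 0 ≤ s - b := sub_nonneg.2 hs
  obtain ⟨y, hy, hyε⟩ : ∃ y ∈ Ioo m 1,
      Real.sqrt (M.khat y) * (s - b) < Real.sqrt (M.khat m) * (s - b) + ε := by
    have hc : ContinuousAt (fun y => Real.sqrt (M.khat y) * (s - b)) m :=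
      (Real.continuous_sqrt.continuousAt.comp (H.hasDerivAt_khat m hm).continuousAt).mul
        continuousAt_const
    have h1 := (hc.eventually_lt_const (lt_add_of_pos_right _ hε)).filter_mono
      (nhdsWithin_le_nhds (s := Ioi m))
    exact (Eventually.and (Ioo_mem_nhdsGT hm.2) h1).exists
  set hat : ℝ → ℝ := fun t => (s - b) / (y - m) ^ 2 * max 0 (y - t) with hhat
  have hhatc : Continuous hat := by rw [hhat]; fun_prop
  have hhat0 : ∀ t, 0 ≤ hat t := fun t => mul_nonneg (by positivity) (le_max_left _ _)
  have hslope := H.continuousOn_slope hm' hl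
  have hslack := H.continuousOn_slack hm' hl.le
  set q₀ : ℝ → ℝ := fun t => M.slope l t + hat t with hq₀
  set R₀ : ℝ → ℝ := fun t => l * M.slope l t + M.slack l t + Real.sqrt (M.khat y) * hat t with hR₀
  have hq₀c : ContinuousOn q₀ (Icc m 1) := hslope.add hhatc.continuousOn
  have hR₀c : ContinuousOn R₀ (Icc m 1) :=
    ((continuousOn_const.mul hslope).add hslack).add (continuousOn_const.mul hhatc.continuousOn)
  have hI := H.intervalIntegrable_slope hm' hl
  have hJ := H.intervalIntegrable_slack hm' hl.le (left_mem_Icc.2 hm.2.le) (right_mem_Icc.2 hm.2.le)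
  have hK := hhatc.intervalIntegrable (μ := volume) m 1
  have hhatI : ∫ t in m..1, hat t = (s - b) / 2 := integral_hat hy.1 hy.2.le
  refine ⟨fun t => q₀ (fold m t), fun t => R₀ (fold m t),
    ⟨continuous_comp_fold hm.2.le hq₀c, ?_, ?_, continuous_comp_fold hm.2.le hR₀c, ?_⟩, ?_⟩
  · obtain ⟨C, hC⟩ := isCompact_Icc.exists_bound_of_continuousOn hq₀c
    exact ⟨C, fun t => hC _ (fold_mem hm.2.le t)⟩
  · rw [integral_comp_fold hm.2.le hq₀c, intervalIntegral.integral_add hI hK, hhatI]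
    linarith
  · intro t ht
    rw [← fold_eq ⟨ht.1.le, ht.2.le⟩]
    have hf := IsCompetitor.height_mem hm ht
    rw [← fold_eq ⟨ht.1.le, ht.2.le⟩] at hf
    have hfm := (fold_mem hm.2.le t).1
    set x := fold m t
    have hlx := hl.trans_le (H.khat_mono hm.1.le hfm hf.2)
    have hkx := H.khat_nonneg hf
    have hω : 0 ≤ M.ω (1 - x) := by rw [← H.wt_sq x ⟨hf.1, hf.2.le⟩]; positivity
    have e1 := H.sqrt_slope_eq hf hl0 hlx
    have e2 : Real.sqrt (M.khat x) * hat x ≤ Real.sqrt (M.khat y) * hat x := by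
      rcases le_total x y with hxy | hxy
      · exact mul_le_mul_of_nonneg_right
          (Real.sqrt_le_sqrt (H.khat_mono hf.1 hxy hy.2)) (hhat0 x)
      · have : hat x = 0 := by
          rw [hhat]
          simp only
          rw [max_eq_left (by linarith), mul_zero]
        simp [this]
    -- This is the triangle inequality in the plane: adding `hat x` to the slope lengthens the
    -- vector by at most √khat(x) `hat x`.
    have e3 : Real.sqrt (M.khat x * q₀ x ^ 2 + M.ω (1 - x)) ≤
        Real.sqrt (M.khat x * M.slope l x ^ 2 + M.ω (1 - x)) + Real.sqrt (M.khat x) * hat x := by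
      have h1 := mul_nonneg (Real.sqrt_nonneg (M.khat x)) (hhat0 x)
      refine Real.sqrt_le_iff.2 ⟨by positivity, ?_⟩
      have h2 : Real.sqrt (M.khat x) * M.slope l x ≤
          Real.sqrt (M.khat x * M.slope l x ^ 2 + M.ω (1 - x)) := by
        refine Real.le_sqrt_of_sq_le ?_
        rw [mul_pow, Real.sq_sqrt hkx]
        linarith
      have h3 := mul_le_mul_of_nonneg_right h2 h1
      have hA := Real.sq_sqrt (add_nonneg (mul_nonneg hkx (sq_nonneg (M.slope l x))) hω)
      have hS := Real.sq_sqrt hkx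
      simp only [hq₀]
      linear_combination 2 * h3 - hA - (2 * M.slope l x * hat x + hat x ^ 2) * hS
    simp only [hR₀]
    linarith
  · rw [integral_comp_fold hm.2.le hR₀c, intervalIntegral.integral_add
      ((hI.const_mul l).add hJ) (hK.const_mul _), intervalIntegral.integral_add (hI.const_mul l) hJ,
      intervalIntegral.integral_const_mul, intervalIntegral.integral_const_mul, hhatI, dual]
    have : ∫ t in m..1, M.slope l t = b / 2 := by rw [hb]; ring
    rw [this]
    linarith

end CohesiveFracture.Model.Regular

/-! ### Duality: `maxDual` equals `frakG` and has infimum `g` -/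

namespace CohesiveFracture.Model

/-- The largest of the lower bounds for the energy of paths reaching the height `m`. -/
noncomputable def maxDual (M : Model) (s m : ℝ) : ℝ≥0∞ :=
  ⨆ l ∈ Icc 0 (Real.sqrt (M.khat m)), ENNReal.ofReal (M.dual s m l)

variable {M : Model}

theorem ofReal_dual_le_maxDual {s m l : ℝ} (hl : l ∈ Icc 0 (Real.sqrt (M.khat m))) :
    ENNReal.ofReal (M.dual s m l) ≤ M.maxDual s m :=
  le_iSup₂ (f := fun l (_ : l ∈ Icc 0 (Real.sqrt (M.khat m))) => ENNReal.ofReal (M.dual s m l)) l hl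

theorem maxDual_mono {s s' m : ℝ} (h : s ≤ s') : M.maxDual s m ≤ M.maxDual s' m :=
  iSup₂_mono fun _ hl => ENNReal.ofReal_le_ofReal
    (add_le_add_left (mul_le_mul_of_nonneg_left h hl.1) _)

/-- `maxDual` is a supremum of affine functions of s with slopes at most √khat(m). This estimate
gives access to the borderline case s = sup Φ. -/
theorem maxDual_le_add {s s' m : ℝ} (h : s ≤ s') : M.maxDual s' m ≤
    M.maxDual s m + ENNReal.ofReal (Real.sqrt (M.khat m) * (s' - s)) := by
  refine iSup₂_le fun l hl => ?_
  refine le_trans ?_ (add_le_add_left (ofReal_dual_le_maxDual hl) _)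
  refine le_trans (ENNReal.ofReal_le_ofReal ?_) ENNReal.ofReal_add_le
  have := mul_le_mul_of_nonneg_right hl.2 (sub_nonneg.2 h)
  rw [dual, dual]
  linarith

namespace Regular

theorem sq_le_khat (H : M.Regular) {m l : ℝ} (hm : m ∈ Ico (0 : ℝ) 1)
    (hl : l ∈ Icc 0 (Real.sqrt (M.khat m))) : l ^ 2 ≤ M.khat m :=
  (Real.le_sqrt hl.1 (H.khat_nonneg hm)).1 hl.2

theorem continuousOn_integral_wt (H : M.Regular) :
    ContinuousOn (fun m => ∫ t in m..1, M.wt t) (Icc 0 1) := by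
  have h := intervalIntegral.continuousOn_primitive_interval_left (a := (0 : ℝ)) (b := 1)
    (f := M.wt) (μ := volume) (by
      rw [uIcc_of_le zero_le_one]; exact H.continuousOn_wt.integrableOn_Icc)
  rwa [uIcc_of_le zero_le_one] at h

theorem integral_slack_le (H : M.Regular) {m l : ℝ} (hm : m ∈ Ico (0 : ℝ) 1)
    (hl : l ^ 2 ≤ M.khat m) : ∫ t in m..1, M.slack l t ≤ ∫ t in m..1, M.wt t :=
  intervalIntegral.integral_mono_on hm.2.le
    (H.intervalIntegrable_slack hm hl (left_mem_Icc.2 hm.2.le) (right_mem_Icc.2 hm.2.le))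
    (H.intervalIntegrable_wt ⟨hm.1, hm.2.le⟩ (right_mem_Icc.2 zero_le_one))
    fun _ ht => H.slack_le_wt ⟨hm.1.trans ht.1, ht.2⟩

theorem dual_nonneg {s m l : ℝ} (hs : 0 ≤ s) (hm : m ≤ 1) (hl : 0 ≤ l) : 0 ≤ M.dual s m l :=
  add_nonneg (mul_nonneg hl hs) (mul_nonneg two_pos.le
    (intervalIntegral.integral_nonneg hm fun t _ => M.slack_nonneg l t))

/-- Together with the next two lower bounds this determines the limits at both ends: √khat tends to
0 at 0, and the integral of `wt` over [m,1] tends to 0 as m tends to 1. -/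
theorem maxDual_le (H : M.Regular) {s m : ℝ} (hs : 0 ≤ s) (hm : m ∈ Ico (0 : ℝ) 1) :
    M.maxDual s m ≤ ENNReal.ofReal (Real.sqrt (M.khat m)) * ENNReal.ofReal s +
      ENNReal.ofReal (2 * ∫ t in m..1, M.wt t) := by
  refine iSup₂_le fun l hl => ?_
  rw [← ENNReal.ofReal_mul (Real.sqrt_nonneg _)]
  refine le_trans (ENNReal.ofReal_le_ofReal ?_) ENNReal.ofReal_add_le
  exact add_le_add (mul_le_mul_of_nonneg_right hl.2 hs)
    (mul_le_mul_of_nonneg_left (H.integral_slack_le hm (H.sq_le_khat hm hl)) two_pos.le)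

theorem le_maxDual_of_slope {s m : ℝ} (hm : m ≤ 1) :
    ENNReal.ofReal (Real.sqrt (M.khat m)) * ENNReal.ofReal s ≤ M.maxDual s m := by
  refine le_trans ?_ (ofReal_dual_le_maxDual ⟨Real.sqrt_nonneg _, le_rfl⟩)
  rw [← ENNReal.ofReal_mul (Real.sqrt_nonneg _)]
  refine ENNReal.ofReal_le_ofReal (le_add_of_nonneg_right (mul_nonneg two_pos.le
    (intervalIntegral.integral_nonneg hm fun t _ => M.slack_nonneg _ t)))

theorem le_maxDual_zero {s m : ℝ} :
    ENNReal.ofReal (2 * ∫ t in m..1, M.wt t) ≤ M.maxDual s m := by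
  refine le_trans ?_ (ofReal_dual_le_maxDual ⟨le_rfl, Real.sqrt_nonneg _⟩)
  simp [dual, slack_zero]

theorem maxDual_ne_top (H : M.Regular) {s m : ℝ} (hs : 0 ≤ s) (hm : m ∈ Ico (0 : ℝ) 1) :
    M.maxDual s m ≠ ⊤ :=
  ne_top_of_le_ne_top (by finiteness) (H.maxDual_le hs hm)

theorem tendsto_maxDual_zero (H : M.Regular) {s : ℝ} (hs : 0 ≤ s) :
    Tendsto (M.maxDual s) (𝓝[>] 0) (𝓝 (ENNReal.ofReal (2 * M.Psi 1))) := by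
  have hev : ∀ᶠ m : ℝ in 𝓝[>] 0, m ∈ Ico (0 : ℝ) 1 := by
    filter_upwards [Ioo_mem_nhdsGT (zero_lt_one' ℝ)] with t ht using ⟨ht.1.le, ht.2⟩
  have h1 : Tendsto (fun m => ENNReal.ofReal (2 * ∫ t in m..1, M.wt t)) (𝓝[>] 0)
      (𝓝 (ENNReal.ofReal (2 * M.Psi 1))) :=
    ENNReal.tendsto_ofReal (((H.continuousOn_integral_wt 0 ⟨le_rfl, zero_le_one⟩).mono_left
      (nhdsWithin_le_of_mem (mem_of_superset hev Ico_subset_Icc_self))).const_mul 2)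
  have h2 : Tendsto (fun m => ENNReal.ofReal (Real.sqrt (M.khat m))) (𝓝[>] 0) (𝓝 0) := by
    have h3 : Tendsto M.khat (𝓝[>] 0) (𝓝 (M.khat 0)) :=
      (H.continuousOn_khat 0 ⟨le_rfl, zero_lt_one⟩).mono_left (nhdsWithin_le_of_mem hev)
    have := ENNReal.tendsto_ofReal ((Real.continuous_sqrt.tendsto _).comp h3)
    simpa [H.khat_zero] using this
  have h3 := (ENNReal.Tendsto.mul_const (b := ENNReal.ofReal s) h2 (Or.inr (by finiteness))).add h1
  rw [zero_mul, zero_add] at h3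
  refine tendsto_of_tendsto_of_tendsto_of_le_of_le' h1 h3 ?_ ?_
  · exact Eventually.of_forall fun m => le_maxDual_zero
  · filter_upwards [hev] with m hm using H.maxDual_le hs hm

theorem tendsto_maxDual_one (H : M.Regular) {s : ℝ} (hs : 0 ≤ s) :
    Tendsto (M.maxDual s) (𝓝[<] 1) (𝓝 (M.σ * ENNReal.ofReal s)) := by
  have hev : ∀ᶠ m : ℝ in 𝓝[<] 1, m ∈ Ico (0 : ℝ) 1 := by
    filter_upwards [Ioo_mem_nhdsLT (zero_lt_one' ℝ)] with t ht using ⟨ht.1.le, ht.2⟩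
  have h1 : Tendsto (fun m => ENNReal.ofReal (2 * ∫ t in m..1, M.wt t)) (𝓝[<] 1) (𝓝 0) := by
    have := ENNReal.tendsto_ofReal
      (((H.continuousOn_integral_wt 1 ⟨zero_le_one, le_rfl⟩).mono_left
      (nhdsWithin_le_of_mem (mem_of_superset hev Ico_subset_Icc_self))).const_mul 2)
    simpa using this
  have h2 := ENNReal.Tendsto.mul_const (b := ENNReal.ofReal s) H.tendsto_sqrt_khat
    (Or.inr (by finiteness))
  have h3 := h2.add h1
  rw [add_zero] at h3
  refine tendsto_of_tendsto_of_tendsto_of_le_of_le' h2 h3 ?_ ?_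
  · filter_upwards [hev] with m hm using le_maxDual_of_slope hm.2.le
  · filter_upwards [hev] with m hm using H.maxDual_le hs hm

/-- Slopes below the critical one come with competitors whose energy is nearly `maxDual s m`. -/
theorem exists_competitor_le (H : M.Regular) {m s ε : ℝ} (hm : m ∈ Ioo (0 : ℝ) 1) (hs : 0 ≤ s)
    (hε : 0 < ε) : ∃ q R, M.IsCompetitor m s q R ∧
      ENNReal.ofReal (∫ t in (2 * m - 1)..1, R t) ≤ M.maxDual s m + ENNReal.ofReal ε := by
  have hm' : m ∈ Ico (0 : ℝ) 1 := ⟨hm.1.le, hm.2⟩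
  set l₀ := Real.sqrt (M.khat m) with hl₀
  have hl₀p : 0 < l₀ := Real.sqrt_pos.2 (H.khat_pos hm)
  have hsq : ∀ l, 0 ≤ l → l < l₀ → l ^ 2 < M.khat m := fun l h0 h => (Real.lt_sqrt h0).1 h
  -- `dual s m` is concave in l. Either its derivative s - 2∫`slope` stays nonnegative up to l₀, and
  -- any l close to l₀ has a small defect, or it changes sign, and a zero of it has defect 0. The
  -- denominator s + 1 avoids dividing by s = 0.
  obtain ⟨l, hl0, hl, hb, hδ⟩ : ∃ l, 0 ≤ l ∧ l < l₀ ∧ 2 * ∫ t in m..1, M.slope l t ≤ s ∧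
      (l₀ - l) * (s - 2 * ∫ t in m..1, M.slope l t) ≤ ε / 2 := by
    by_cases hall : ∀ l, 0 ≤ l → l < l₀ → 2 * ∫ t in m..1, M.slope l t ≤ s
    · have hlt : max 0 (l₀ - ε / (2 * (s + 1))) < l₀ :=
        max_lt hl₀p (sub_lt_self _ (by positivity))
      refine ⟨_, le_max_left _ _, hlt, hall _ (le_max_left _ _) hlt, ?_⟩
      have h1 : l₀ - max 0 (l₀ - ε / (2 * (s + 1))) ≤ ε / (2 * (s + 1)) := by
        linarith [le_max_right 0 (l₀ - ε / (2 * (s + 1)))]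
      have h2 : 0 ≤ ∫ t in m..1, M.slope (max 0 (l₀ - ε / (2 * (s + 1)))) t :=
        intervalIntegral.integral_nonneg hm.2.le fun t _ => M.slope_nonneg _ t
      calc _ ≤ ε / (2 * (s + 1)) * (s + 1) :=
            mul_le_mul h1 (by linarith)
              (by linarith [hall _ (le_max_left _ _) hlt]) (by positivity)
        _ = ε / 2 := by field_simp
    · push Not at hall
      obtain ⟨l₁, h0, h1, h2⟩ := hall
      have hc := (H.continuousOn_integral_slope hm' (hsq l₁ h0 h1)).const_smul (2 : ℝ)
      have : s ∈ Icc ((2 : ℝ) • ∫ t in m..1, M.slope 0 t) ((2 : ℝ) • ∫ t in m..1, M.slope l₁ t) :=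
        ⟨by simpa [slope_zero] using hs, by simpa using h2.le⟩
      obtain ⟨l, hl, hls⟩ := intermediate_value_Icc h0 hc this
      simp only [Pi.smul_apply, smul_eq_mul] at hls
      exact ⟨l, hl.1, hl.2.trans_lt h1, hls.le, by rw [hls]; simpa using by positivity⟩
  obtain ⟨q, R, hqR, hle⟩ := H.exists_isCompetitor hm hl0 (hsq l hl0 hl) hb (half_pos hε)
  refine ⟨q, R, hqR, ?_⟩
  refine le_trans ?_ (add_le_add_left (ofReal_dual_le_maxDual ⟨hl0, hl.le⟩) _)
  refine le_trans (ENNReal.ofReal_le_ofReal ?_) ENNReal.ofReal_add_le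
  linarith

theorem g_le_maxDual (H : M.Regular) {m s : ℝ} (hm : m ∈ Ioo (0 : ℝ) 1) (hs : 0 ≤ s) :
    M.g s ≤ M.maxDual s m := by
  refine ENNReal.le_of_forall_pos_le_add fun ε hε _ => ?_
  obtain ⟨q, R, h, hle⟩ := H.exists_competitor_le hm hs (NNReal.coe_pos.2 hε)
  rw [ENNReal.ofReal_coe_nnreal] at hle
  exact (h.g_le H hm).trans hle

theorem frakG_eq_maxDual (H : M.Regular) {m s : ℝ} (hm : m ∈ Ioo (0 : ℝ) 1) (hs : 0 ≤ s) :
    M.frakG s m = M.maxDual s m := by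
  refine le_antisymm (ENNReal.le_of_forall_pos_le_add fun ε hε _ => ?_)
    (le_iInf_lscEnvelope fun w => iSup₂_le fun l hl => ?_)
  · obtain ⟨q, R, h, hle⟩ := H.exists_competitor_le hm hs (NNReal.coe_pos.2 hε)
    rw [ENNReal.ofReal_coe_nnreal] at hle
    exact (h.frakG_le H hm).trans hle
  · exact le_iInf fun u => le_iInf₂ fun hu hu0 => le_iInf₂ fun hu1 _ =>
      H.le_Gm hm hl.1 (H.sq_le_khat ⟨hm.1.le, hm.2⟩ hl) hu hu0 hu1

theorem le_of_tendsto_maxDual {f : Filter ℝ} [f.NeBot] {s : ℝ} {K L : ℝ≥0∞}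
    (hf : Ioo (0 : ℝ) 1 ∈ f) (hL : Tendsto (M.maxDual s) f (𝓝 L))
    (h : ∀ m ∈ Ioo (0 : ℝ) 1, K ≤ M.maxDual s m) : K ≤ L :=
  ge_of_tendsto hL (mem_of_superset hf h)

/-- The height β attains its minimum, and that minimum is the turning height to which the
calibration bound applies. -/
theorem le_g (H : M.Regular) {s : ℝ} {K : ℝ≥0∞} (hs : 0 ≤ s)
    (h : ∀ m ∈ Ioo (0 : ℝ) 1, K ≤ M.maxDual s m) : K ≤ M.g s := by
  refine le_iInf₂ fun p hp => ?_
  obtain ⟨γ, β⟩ := p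
  obtain ⟨-, hβ, -, -, hβI, -, -⟩ := id hp
  have hc : ContinuousOn β (Icc 0 1) := by
    have := hβ.1.continuousOn
    rwa [uIcc_of_le zero_le_one] at this
  obtain ⟨x₀, hx₀, hmin⟩ := isCompact_Icc.exists_isMinOn (nonempty_Icc.2 zero_le_one) hc
  rw [isMinOn_iff] at hmin
  have hb := hβI x₀ hx₀
  simp only at hb
  rcases hb.2.eq_or_lt with h1 | h1
  -- Here β stays at 1, so the slopes √khat(m) are admissible for every m < 1, and their supremum
  -- gives σs.
  · refine (le_of_tendsto_maxDual (Ioo_mem_nhdsLT zero_lt_one) (H.tendsto_maxDual_one hs) h).trans ?_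
    refine le_of_tendsto (ENNReal.Tendsto.mul_const (b := ENNReal.ofReal s) H.tendsto_sqrt_khat
      (Or.inr (by finiteness))) ?_
    filter_upwards [Ioo_mem_nhdsLT (zero_lt_one' ℝ)] with m hm
    have hm' : m ∈ Ico (0 : ℝ) 1 := ⟨hm.1.le, hm.2⟩
    have := H.le_energy hm' (Real.sqrt_nonneg _) (Real.sq_sqrt (H.khat_nonneg hm')).le hp
      (fun x hx => by linarith [hmin x hx, hm.2]) hx₀
    rwa [h1, dual, intervalIntegral.integral_same, mul_zero, add_zero,
      ENNReal.ofReal_mul (Real.sqrt_nonneg _)] at this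
  rcases hb.1.eq_or_lt with h0 | h0
  -- At height 0 the weight khat vanishes, so only l = 0 is admissible, and it gives 2Ψ(1).
  · refine (le_of_tendsto_maxDual (Ioo_mem_nhdsGT zero_lt_one) (H.tendsto_maxDual_zero hs) h).trans ?_
    have := H.le_energy ⟨le_rfl, zero_lt_one⟩ le_rfl (by simp [H.khat_zero]) hp
      (fun x hx => by rw [h0]; exact hmin x hx) hx₀
    rw [← h0] at this
    simpa [dual, slack_zero, Psi, wt] using this
  · exact (h _ ⟨h0, h1⟩).trans (iSup₂_le fun l hl => H.le_energy ⟨h0.le, h1⟩ hl.1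
      (H.sq_le_khat ⟨h0.le, h1⟩ hl) hp hmin hx₀)

end Regular
end CohesiveFracture.Model

/-! ### Comparison of turning heights -/

namespace CohesiveFracture.Model

variable {M : Model}

namespace Regular

theorem sq_sqrt_khat (H : M.Regular) {m : ℝ} (hm : m ∈ Ioo (0 : ℝ) 1) :
    Real.sqrt (M.khat m) ^ 2 = M.khat m := Real.sq_sqrt (H.khat_pos hm).le

theorem dual_add (H : M.Regular) {s m m' l : ℝ} (hm : 0 ≤ m) (hmm : m ≤ m') (hm' : m' < 1)
    (hl : l ^ 2 ≤ M.khat m) : M.dual s m l = M.dual s m' l + 2 * ∫ t in m..m', M.slack l t := by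
  have hI : m ∈ Ico (0 : ℝ) 1 := ⟨hm, hmm.trans_lt hm'⟩
  have h1 : m ∈ Icc m 1 := ⟨le_rfl, hI.2.le⟩
  rw [dual, dual, ← intervalIntegral.integral_add_adjacent_intervals (b := m')
    (H.intervalIntegrable_slack hI hl h1 ⟨hmm, hm'.le⟩)
    (H.intervalIntegrable_slack hI hl ⟨hmm, hm'.le⟩ ⟨hI.2.le, le_rfl⟩)]
  ring

/-- The tangent line inequality for the concave function `dual s m`. -/
theorem dual_le_tangent (H : M.Regular) {s m l l' : ℝ} (hm : m ∈ Ico (0 : ℝ) 1) (hl0 : 0 ≤ l)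
    (hl : l ^ 2 ≤ M.khat m) (hl' : l' ^ 2 ≤ M.khat m)
    (hint : IntervalIntegrable (M.slope l) volume m 1) :
    M.dual s m l' ≤ M.dual s m l + (l' - l) * (s - 2 * ∫ t in m..1, M.slope l t) := by
  have h1 : m ∈ Icc m 1 := ⟨le_rfl, hm.2.le⟩
  have h2 : (1 : ℝ) ∈ Icc m 1 := ⟨hm.2.le, le_rfl⟩
  have hI := H.intervalIntegrable_slack hm hl h1 h2
  have := intervalIntegral.integral_mono_on_of_le_Ioo hm.2.le
    (H.intervalIntegrable_slack hm hl' h1 h2) (hI.add (hint.const_mul (l - l'))) fun t ht => by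
      have hkt := H.khat_lt hm.1 ht.1 ht.2
      exact H.slack_le_slack_add ⟨hm.1.trans ht.1.le, ht.2⟩ hl0 (hl.trans_lt hkt)
        (hl'.trans hkt.le)
  rw [intervalIntegral.integral_add hI (hint.const_mul _),
    intervalIntegral.integral_const_mul] at this
  rw [dual, dual]
  linarith

/-- The gap η is uniform in l because a merely pointwise strict inequality could be lost in the
supremum. -/
theorem maxDual_lt_maxDual (H : M.Regular) {s m m' η : ℝ} (hs : 0 ≤ s) (hm : m ∈ Ioo (0 : ℝ) 1)
    (hm' : m' ∈ Ioo (0 : ℝ) 1) (hη : 0 < η)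
    (h : ∀ l ∈ Icc 0 (Real.sqrt (M.khat m')), ∃ l' ∈ Icc 0 (Real.sqrt (M.khat m)),
      M.dual s m' l + η ≤ M.dual s m l') : M.maxDual s m' < M.maxDual s m := by
  have hle : M.maxDual s m' ≤ M.maxDual s m - ENNReal.ofReal η := by
    refine iSup₂_le fun l hl => ?_
    obtain ⟨l', hl', h'⟩ := h l hl
    refine ENNReal.le_sub_of_add_le_right ENNReal.ofReal_ne_top ?_
    rw [← ENNReal.ofReal_add (dual_nonneg hs hm'.2.le hl.1) hη.le]
    exact (ENNReal.ofReal_le_ofReal h').trans (ofReal_dual_le_maxDual hl')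
  have htop := H.maxDual_ne_top hs ⟨hm.1.le, hm.2⟩
  have hpos : M.maxDual s m ≠ 0 := by
    obtain ⟨l', hl', h'⟩ := h 0 ⟨le_rfl, Real.sqrt_nonneg _⟩
    have h0 : 0 < M.dual s m l' :=
      (add_pos_of_nonneg_of_pos (dual_nonneg hs hm'.2.le le_rfl) hη).trans_le h'
    exact ((ENNReal.ofReal_pos.2 h0).trans_le (ofReal_dual_le_maxDual hl')).ne'
  exact hle.trans_lt (ENNReal.sub_lt_self htop hpos (ENNReal.ofReal_pos.2 hη).ne')

/-- If the geodesic through height `m` is too long for the displacement `s`, it pays to turn at a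
larger height. -/
theorem exists_gt_maxDual_lt (H : M.Regular) {s m : ℝ} (hs : 0 ≤ s) (hm : m ∈ Ioo (0 : ℝ) 1)
    (h : ENNReal.ofReal s < M.Phi m) : ∃ m' ∈ Ioo m 1, M.maxDual s m' < M.maxDual s m := by
  have hmI : m ∈ Ico (0 : ℝ) 1 := ⟨hm.1.le, hm.2⟩
  set l₀ := Real.sqrt (M.khat m) with hl₀
  have hl₀sq : l₀ ^ 2 = M.khat m := H.sq_sqrt_khat hm
  -- Φ(m) may be infinite and its integrand is singular at m. By monotone convergence the part of
  -- the integral above some m' > m already exceeds s, and there the slope l₀ is subcritical.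
  obtain ⟨m', hm', hlt⟩ : ∃ m' ∈ Ioo m 1, s < 2 * ∫ t in m'..1, M.slope l₀ t := by
    obtain ⟨u, hu, hum, hut⟩ := exists_seq_strictAnti_tendsto' hm.2
    have hU : Ioo m 1 = ⋃ n, Ioo (u n) 1 := by
      ext t
      simp only [mem_iUnion, mem_Ioo]
      constructor
      · rintro ⟨h1, h2⟩
        obtain ⟨n, hn⟩ := (hut.eventually_lt_const h1).exists
        exact ⟨n, hn, h2⟩
      · rintro ⟨n, h1, h2⟩
        exact ⟨(hum n).1.trans h1, h2⟩
    have hmono : Monotone fun n => Ioo (u n) 1 := fun i j hij =>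
      Ioo_subset_Ioo_left (hu.antitone hij)
    rw [Phi, B, hU, setLIntegral_iUnion_of_directed _ hmono.directed_le, ENNReal.mul_iSup,
      lt_iSup_iff] at h
    obtain ⟨n, hn⟩ := h
    refine ⟨u n, hum n, ?_⟩
    have hI : u n ∈ Ico (0 : ℝ) 1 := ⟨hm.1.le.trans (hum n).1.le, (hum n).2⟩
    have hint := H.intervalIntegrable_slope (l := l₀) hI (by
      rw [hl₀sq]; exact H.khat_lt hm.1.le (hum n).1 (hum n).2)
    rw [show (2 : ℝ≥0∞) = ENNReal.ofReal 2 by simp] at hn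
    change _ < ENNReal.ofReal 2 * ∫⁻ t in Ioo (u n) 1, ENNReal.ofReal (M.slope l₀ t) at hn
    rw [← ofReal_integral_eq_lintegral_ofReal, ← integral_Ioc_eq_integral_Ioo,
      ← intervalIntegral.integral_of_le hI.2.le, ← ENNReal.ofReal_mul two_pos.le,
      ENNReal.ofReal_lt_ofReal_iff_of_nonneg hs] at hn
    · exact hn
    · exact ((intervalIntegrable_iff_integrableOn_Ioc_of_le hI.2.le).1 hint).mono_set
        Ioo_subset_Ioc_self
    · exact Eventually.of_forall fun t => M.slope_nonneg _ t
  have hm'I : m' ∈ Ioo (0 : ℝ) 1 := ⟨hm.1.trans hm'.1, hm'.2⟩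
  have hkk := H.khat_lt hm.1.le hm'.1 hm'.2
  have hl₀' : l₀ ^ 2 < M.khat m' := by rwa [hl₀sq]
  have hp : m ∈ Icc m 1 := ⟨le_rfl, hm.2.le⟩
  have hp' : m' ∈ Icc m 1 := ⟨hm'.1.le, hm'.2.le⟩
  have hη : 0 < 2 * ∫ t in m..m', M.slack l₀ t := by
    refine mul_pos two_pos (intervalIntegral.intervalIntegral_pos_of_pos_on
      (H.intervalIntegrable_slack hmI hl₀sq.le hp hp') (fun t ht => ?_) hm'.1)
    have ht1 := ht.2.trans hm'.2
    have hkt := H.khat_lt hm.1.le ht.1 ht1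
    refine mul_pos (H.wt_pos t ⟨hm.1.le.trans ht.1.le, ht1⟩) (Real.sqrt_pos.2 ?_)
    rw [hl₀sq, sub_pos, div_lt_one ((H.khat_pos hm).trans hkt)]
    exact hkt
  refine ⟨m', hm', H.maxDual_lt_maxDual hs hm hm'I hη fun l hl => ?_⟩
  -- For l ≤ l₀ the same l serves at m, as `slack` decreases in l and so gains at least η on [m,m'].
  -- For l ≥ l₀ the function `dual s m'` lies below its tangent at l₀, which is decreasing, so l₀
  -- does at least as well.
  rcases le_total l l₀ with hll | hll
  · refine ⟨l, ⟨hl.1, hll⟩, ?_⟩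
    have hlsq : l ^ 2 ≤ M.khat m := H.sq_le_khat hmI ⟨hl.1, hll⟩
    rw [H.dual_add hm.1.le hm'.1.le hm'.2 hlsq]
    have : ∫ t in m..m', M.slack l₀ t ≤ ∫ t in m..m', M.slack l t := by
      refine intervalIntegral.integral_mono_on hm'.1.le
        (H.intervalIntegrable_slack hmI hl₀sq.le hp hp')
        (H.intervalIntegrable_slack hmI hlsq hp hp') fun t ht => ?_
      refine mul_le_mul_of_nonneg_left (Real.sqrt_le_sqrt ?_) (Real.sqrt_nonneg _)
      have := H.khat_nonneg (t := t) ⟨hm.1.le.trans ht.1, ht.2.trans_lt hm'.2⟩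
      have h2 := pow_le_pow_left₀ hl.1 hll 2
      gcongr
    linarith
  · refine ⟨l₀, ⟨Real.sqrt_nonneg _, le_rfl⟩, ?_⟩
    rw [H.dual_add hm.1.le hm'.1.le hm'.2 hl₀sq.le]
    have := H.dual_le_tangent (s := s) ⟨hm'I.1.le, hm'I.2⟩ (Real.sqrt_nonneg _) hl₀'.le
      (H.sq_le_khat ⟨hm'I.1.le, hm'I.2⟩ hl)
      (H.intervalIntegrable_slope ⟨hm'I.1.le, hm'I.2⟩ hl₀')
    nlinarith [mul_nonneg (sub_nonneg.2 hll) (sub_nonneg.2 hlt.le)]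

theorem intervalIntegrable_slope_of_Phi_ne_top (H : M.Regular) {m : ℝ} (hm : m ∈ Ioo (0 : ℝ) 1)
    (h : M.Phi m ≠ ⊤) : IntervalIntegrable (M.slope (Real.sqrt (M.khat m))) volume m 1 ∧
      M.Phi m = ENNReal.ofReal (2 * ∫ t in m..1, M.slope (Real.sqrt (M.khat m)) t) := by
  set l₀ := Real.sqrt (M.khat m) with hl₀
  have hl₀sq : l₀ ^ 2 = M.khat m := H.sq_sqrt_khat hm
  have hPhi : M.Phi m = 2 * ∫⁻ t in Ioo m 1, ENNReal.ofReal (M.slope l₀ t) := rfl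
  have hmeas : AEStronglyMeasurable (M.slope l₀) (volume.restrict (Ioo m 1)) := by
    refine ContinuousOn.aestronglyMeasurable (fun t ht => ?_) measurableSet_Ioo
    obtain ⟨y, hy⟩ := exists_between ht.1
    have hk := H.khat_lt hm.1.le hy.1 (hy.2.trans ht.2)
    exact ((H.continuousOn_slope ⟨hm.1.le.trans hy.1.le, hy.2.trans ht.2⟩ (hl₀sq.trans_lt hk)
      ).continuousAt (Icc_mem_nhds hy.2 ht.2)).continuousWithinAt
  have hfin : ∫⁻ t in Ioo m 1, ENNReal.ofReal (M.slope l₀ t) ≠ ⊤ := fun htop => by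
    rw [hPhi, htop] at h
    exact h (ENNReal.mul_top two_ne_zero)
  have hint : IntegrableOn (M.slope l₀) (Ioo m 1) volume :=
    (lintegral_ofReal_ne_top_iff_integrable hmeas
      (Eventually.of_forall fun t => M.slope_nonneg _ t)).1 hfin
  refine ⟨(intervalIntegrable_iff_integrableOn_Ioo_of_le hm.2.le).2 hint, ?_⟩
  rw [hPhi, ENNReal.ofReal_mul two_pos.le, intervalIntegral.integral_of_le hm.2.le,
    integral_Ioc_eq_integral_Ioo, ofReal_integral_eq_lintegral_ofReal hint
    (Eventually.of_forall fun t => M.slope_nonneg _ t)]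
  simp

/-- If the geodesic through height `m` is too short for the displacement `s`, it pays to turn at a
smaller height. -/
theorem exists_lt_maxDual_lt (H : M.Regular) {s m : ℝ} (hs : 0 ≤ s) (hm : m ∈ Ioo (0 : ℝ) 1)
    (h : M.Phi m < ENNReal.ofReal s) : ∃ m' ∈ Ioo 0 m, M.maxDual s m' < M.maxDual s m := by
  have hmI : m ∈ Ico (0 : ℝ) 1 := ⟨hm.1.le, hm.2⟩
  obtain ⟨hint, hPhi⟩ := H.intervalIntegrable_slope_of_Phi_ne_top hm (h.ne_top)
  set l₀ := Real.sqrt (M.khat m) with hl₀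
  have hl₀sq : l₀ ^ 2 = M.khat m := H.sq_sqrt_khat hm
  have hl₀p : 0 < l₀ := Real.sqrt_pos.2 (H.khat_pos hm)
  set b := 2 * ∫ t in m..1, M.slope l₀ t with hb
  have hbs : 0 < s - b := by
    rw [hPhi] at h
    exact sub_pos.2 ((ENNReal.ofReal_lt_ofReal_iff_of_nonneg (mul_nonneg two_pos.le
      (intervalIntegral.integral_nonneg hm.2.le fun t _ => M.slope_nonneg _ t))).1 h)
  obtain ⟨A, hA⟩ := isCompact_Icc.exists_bound_of_continuousOn H.continuousOn_wt
  have hA0 : 0 ≤ A := (norm_nonneg _).trans (hA 0 ⟨le_rfl, zero_le_one⟩)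
  -- Since khat' > 0, lowering the height by h lowers the largest admissible slope by at least c h.
  obtain ⟨c, hc0, hc⟩ : ∃ c > 0, ∀ᶠ x in 𝓝[<] m, c * (m - x) ≤ l₀ - Real.sqrt (M.khat x) := by
    have hd := (H.hasDerivAt_khat m hm).sqrt (H.khat_pos hm).ne'
    have hpos : 0 < deriv M.khat m / (2 * Real.sqrt (M.khat m)) :=
      div_pos (H.deriv_khat_pos m hm) (by positivity)
    obtain ⟨c, hc0, hc⟩ := exists_between hpos
    refine ⟨c, hc0, ?_⟩
    have h1 := ((hasDerivAt_iff_tendsto_slope.1 hd).eventually_const_lt hc).filter_mono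
      (nhdsWithin_mono m (fun x (hx : x < m) => (ne_of_lt hx : x ≠ m)))
    filter_upwards [h1, self_mem_nhdsWithin] with x hx hxm
    rw [slope_def_field, lt_div_iff_of_neg (sub_neg.2 hxm)] at hx
    rw [hl₀]
    linarith
  -- With h = m - m' and δ = l₀ - l ≥ c h, the slope deficit loses δ(s - b), while the added piece
  -- [m',m] gains at most 2hA√(2δ/l₀). The smallness of h makes this gain at most δ(s - b)/2; the
  -- constant 32 comes from squaring, as 2·4². What remains is at least the η chosen below.
  have hsmall : ∀ᶠ x in 𝓝[<] m, (m - x) * (32 * A ^ 2) < l₀ * c * (s - b) ^ 2 := by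
    have h1 : Tendsto (fun x => (m - x) * (32 * A ^ 2)) (𝓝 m) (𝓝 0) :=
      Continuous.tendsto' (by fun_prop) _ _ (by simp)
    exact (h1.mono_left nhdsWithin_le_nhds).eventually_lt_const (by positivity)
  obtain ⟨m', ⟨hcm, hsm⟩, hm'⟩ := ((hc.and hsmall).and (Ioo_mem_nhdsLT hm.1)).exists
  have hm'I : m' ∈ Ioo (0 : ℝ) 1 := ⟨hm'.1, hm'.2.trans hm.2⟩
  have hmm : 0 < m - m' := sub_pos.2 hm'.2
  refine ⟨m', hm', H.maxDual_lt_maxDual hs hm hm'I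
    (η := c * (m - m') * (s - b) / 2) (by positivity) fun l hl => ?_⟩
  refine ⟨l₀, ⟨hl₀p.le, le_rfl⟩, ?_⟩
  have hlsq := H.sq_le_khat ⟨hm'I.1.le, hm'I.2⟩ hl
  have hkk := H.khat_mono hm'.1.le hm'.2.le hm.2
  set δ := l₀ - l with hδ
  have hδc : c * (m - m') ≤ δ := hcm.trans (by rw [hδ]; linarith [hl.2])
  have hδ0 : 0 < δ := (by positivity : 0 < c * (m - m')).trans_le hδc
  have e1 := H.dual_add (s := s) hm'.1.le hm'.2.le hm.2 hlsq
  have e2 := H.dual_le_tangent (s := s) hmI hl₀p.le hl₀sq.le (hlsq.trans hkk) hint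
  have hp : m' ∈ Icc m' 1 := ⟨le_rfl, hm'I.2.le⟩
  have e3 : ∫ t in m'..m, M.slack l t ≤ ∫ _ in m'..m, A * Real.sqrt (2 * δ / l₀) := by
    refine intervalIntegral.integral_mono_on hm'.2.le
      (H.intervalIntegrable_slack ⟨hm'I.1.le, hm'I.2⟩ hlsq hp ⟨hm'.2.le, hm.2.le⟩)
      (by simp) fun t ht => ?_
    have ht0 : 0 ≤ t := hm'.1.le.trans ht.1
    have ht1 : t < 1 := ht.2.trans_lt hm.2
    refine mul_le_mul ((le_abs_self _).trans (hA t ⟨ht0, ht1.le⟩)) (Real.sqrt_le_sqrt ?_)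
      (Real.sqrt_nonneg _) hA0
    have hkt := H.khat_mono ht0 ht.2 hm.2
    have hkt0 := H.khat_pos (t := t) ⟨hm'.1.trans_le ht.1, ht1⟩
    have h1 : l ^ 2 / M.khat m ≤ l ^ 2 / M.khat t := by gcongr
    have h2 : 1 - l ^ 2 / M.khat m ≤ 2 * δ / l₀ := by
      rw [← hl₀sq, sub_le_iff_le_add, div_add_div _ _ hl₀p.ne' (by positivity),
        le_div_iff₀ (by positivity)]
      have : 0 ≤ l₀ * (l₀ - l) ^ 2 := by positivity
      rw [hδ]
      linarith
    linarith
  rw [intervalIntegral.integral_const, smul_eq_mul] at e3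
  have e4 : (m - m') * (A * Real.sqrt (2 * δ / l₀)) ≤ δ * (s - b) / 4 := by
    refine abs_le_of_sq_le_sq' ?_ (by positivity) |>.2
    rw [mul_pow, mul_pow, Real.sq_sqrt (by positivity)]
    have h1 : (m - m') * ((m - m') * (32 * A ^ 2)) ≤ (m - m') * (l₀ * c * (s - b) ^ 2) :=
      mul_le_mul_of_nonneg_left hsm.le hmm.le
    have h2 : c * (m - m') * (l₀ * (s - b) ^ 2) ≤ δ * (l₀ * (s - b) ^ 2) :=
      mul_le_mul_of_nonneg_right hδc (by positivity)
    have h3 : (m - m') ^ 2 * (32 * A ^ 2) ≤ δ * l₀ * (s - b) ^ 2 := by linarith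
    have h4 : (m - m') ^ 2 * (A ^ 2 * (2 * δ / l₀)) = (m - m') ^ 2 * (32 * A ^ 2) * δ / (16 * l₀) := by
      field_simp; ring
    rw [h4, div_le_iff₀ (by positivity)]
    have := mul_le_mul_of_nonneg_right h3 hδ0.le
    linarith
  have e5 := mul_le_mul_of_nonneg_right hδc hbs.le
  have e6 : (l - l₀) * (s - b) = -(δ * (s - b)) := by rw [hδ]; ring
  rw [e6] at e2
  linarith

/-- `maxDual s` is lower semicontinuous on `(0,1)`. -/
theorem lowerSemicontinuousOn_maxDual (H : M.Regular) (s : ℝ) :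
    LowerSemicontinuousOn (M.maxDual s) (Ioo 0 1) := by
  intro m₀ hm₀ K hK
  have hm₀I : m₀ ∈ Ico (0 : ℝ) 1 := ⟨hm₀.1.le, hm₀.2⟩
  set l₀ := Real.sqrt (M.khat m₀) with hl₀
  have hl₀p : 0 < l₀ := Real.sqrt_pos.2 (H.khat_pos hm₀)
  simp only [maxDual, lt_iSup_iff] at hK
  obtain ⟨l, hl, hKl⟩ := hK
  -- A slope strictly below l₀ remains admissible at all heights near m₀. If l = l₀, lowering it to
  -- x costs at most (l - x)s, because `slack` only increases.
  obtain ⟨l', hl'0, hl', hKl'⟩ : ∃ l', 0 ≤ l' ∧ l' < l₀ ∧ K < ENNReal.ofReal (M.dual s m₀ l') := by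
    rcases hl.2.lt_or_eq with hlt | heq
    · exact ⟨l, hl.1, hlt, hKl⟩
    have hc : Tendsto (fun x => ENNReal.ofReal (M.dual s m₀ l - (l - x) * s)) (𝓝[<] l₀)
        (𝓝 (ENNReal.ofReal (M.dual s m₀ l))) := by
      refine ENNReal.tendsto_ofReal (Tendsto.mono_left ?_ nhdsWithin_le_nhds)
      exact Continuous.tendsto' (by fun_prop) _ _ (by rw [heq, hl₀]; simp)
    obtain ⟨x, hx, hx0⟩ := ((hc.eventually_const_lt hKl).and (Ioo_mem_nhdsLT hl₀p)).exists
    refine ⟨x, hx0.1.le, hx0.2, hx.trans_le (ENNReal.ofReal_le_ofReal ?_)⟩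
    have hp : m₀ ∈ Icc m₀ 1 := ⟨le_rfl, hm₀.2.le⟩
    have hxsq := H.sq_le_khat hm₀I ⟨hx0.1.le, hx0.2.le⟩
    have : ∫ t in m₀..1, M.slack l t ≤ ∫ t in m₀..1, M.slack x t := by
      refine intervalIntegral.integral_mono_on_of_le_Ioo hm₀.2.le
        (H.intervalIntegrable_slack hm₀I (H.sq_le_khat hm₀I hl) hp ⟨hm₀.2.le, le_rfl⟩)
        (H.intervalIntegrable_slack hm₀I hxsq hp ⟨hm₀.2.le, le_rfl⟩) fun t ht => ?_
      refine mul_le_mul_of_nonneg_left (Real.sqrt_le_sqrt ?_) (Real.sqrt_nonneg _)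
      have := H.khat_nonneg (t := t) ⟨hm₀.1.le.trans ht.1.le, ht.2⟩
      have h2 := pow_le_pow_left₀ hx0.1.le (hx0.2.le.trans heq.ge) 2
      gcongr
    rw [dual, dual]
    linarith
  have hsq : l' ^ 2 < M.khat m₀ := (Real.lt_sqrt hl'0).1 hl'
  have hev : ∀ᶠ m in 𝓝 m₀, l' ^ 2 < M.khat m :=
    (H.hasDerivAt_khat m₀ hm₀).continuousAt.eventually_const_lt hsq
  obtain ⟨m₁, hm₁, hm₁l⟩ : ∃ m₁ ∈ Ioo 0 m₀, l' ^ 2 < M.khat m₁ :=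
    ((hev.filter_mono (nhdsWithin_le_nhds (s := Iio m₀))).and (Ioo_mem_nhdsLT hm₀.1)).exists.imp
      fun _ h => ⟨h.2, h.1⟩
  have hm₁I : m₁ ∈ Ico (0 : ℝ) 1 := ⟨hm₁.1.le, hm₁.2.trans hm₀.2⟩
  have hcont : ContinuousOn (fun m => ∫ t in m..1, M.slack l' t) (uIcc m₁ 1) := by
    refine intervalIntegral.continuousOn_primitive_interval_left ?_
    rw [uIcc_of_le hm₁I.2.le]
    exact (H.continuousOn_slack hm₁I hm₁l.le).integrableOn_Icc
  rw [uIcc_of_le hm₁I.2.le] at hcont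
  have hca : ContinuousAt (fun m => ENNReal.ofReal (M.dual s m l')) m₀ :=
    ENNReal.continuous_ofReal.continuousAt.comp (continuousAt_const.add
      (continuousAt_const.mul (hcont.continuousAt (Icc_mem_nhds hm₁.2 hm₀.2))))
  refine nhdsWithin_le_nhds ?_
  filter_upwards [hev, hca.eventually_const_lt hKl'] with m hm hKm
  exact hKm.trans_le (ofReal_dual_le_maxDual ⟨hl'0, Real.le_sqrt_of_sq_le hm.le⟩)

end Regular
end CohesiveFracture.Model

/-! ### Minimization over the turning height and conclusion -/

/-- A lower semicontinuous function on `I` which at the points outside a compact `J ⊆ I` is larger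
than at a point of `J` has a minimum on `I`. -/
theorem LowerSemicontinuousOn.exists_isMinOn_of_lt {F : ℝ → ℝ≥0∞} {I J : Set ℝ} {x : ℝ}
    (hF : LowerSemicontinuousOn F J) (hJ : IsCompact J) (hx : x ∈ J)
    (h : ∀ y ∈ I, y ∉ J → F x < F y) : ∃ z ∈ J, F z ≤ F x ∧ ∀ y ∈ I, F z ≤ F y := by
  obtain ⟨z, hz, hmin⟩ := hF.exists_isMinOn ⟨x, hx⟩ hJ
  rw [isMinOn_iff] at hmin
  exact ⟨z, hz, hmin x hx, fun y hy => (em (y ∈ J)).elim (hmin y)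
    fun hyJ => (hmin x hx).trans (h y hy hyJ).le⟩

namespace CohesiveFracture.Model.Regular

variable {M : Model}

/-- If all geodesics are longer than `s`, then no turning height is better than `1`. -/
theorem le_maxDual_of_lt_infPhi (H : M.Regular) {s m : ℝ} (hs : 0 ≤ s) (hm : m ∈ Ioo (0 : ℝ) 1)
    (h : ENNReal.ofReal s < M.infPhi) : M.σ * ENNReal.ofReal s ≤ M.maxDual s m := by
  -- Otherwise heights near 1 are worse than m, so a minimizer over [m,1) exists; but Φ exceeds s
  -- there, so a larger height is strictly better.
  by_contra! hlt
  have hev := (H.tendsto_maxDual_one hs).eventually_const_lt hlt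
  obtain ⟨r, hr, hev⟩ := (mem_nhdsLT_iff_exists_Ioo_subset' hm.2).1 hev
  obtain ⟨z, hz, -, hmin⟩ := ((H.lowerSemicontinuousOn_maxDual s).mono
    (fun y (hy : y ∈ Icc m (max m r)) => ⟨hm.1.trans_le hy.1, hy.2.trans_lt (max_lt hm.2 hr)⟩)
    ).exists_isMinOn_of_lt (I := Ico m 1) isCompact_Icc (left_mem_Icc.2 (le_max_left m r))
    fun y hy hyJ => hev ⟨(le_max_right m r).trans_lt (not_le.1 fun hle => hyJ ⟨hy.1, hle⟩), hy.2⟩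
  have hzI : z ∈ Ioo (0 : ℝ) 1 := ⟨hm.1.trans_le hz.1, hz.2.trans_lt (max_lt hm.2 hr)⟩
  obtain ⟨m', hm', hlt'⟩ := H.exists_gt_maxDual_lt hs hzI (h.trans_le (iInf₂_le z hzI))
  exact (hmin m' ⟨hz.1.trans hm'.1.le, hm'.2⟩).not_gt hlt'

/-- The strict case is applied to x < s, and x tends to s; for s > 0 multiplication by σ is
continuous at s even if σ = ∞. -/
theorem le_maxDual_of_le_infPhi (H : M.Regular) {s m : ℝ} (hs : 0 ≤ s) (hm : m ∈ Ioo (0 : ℝ) 1)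
    (h : ENNReal.ofReal s ≤ M.infPhi) : M.σ * ENNReal.ofReal s ≤ M.maxDual s m := by
  rcases hs.eq_or_lt with rfl | hs0
  · simp
  have hc : Tendsto (fun x => M.σ * ENNReal.ofReal x) (𝓝[<] s) (𝓝 (M.σ * ENNReal.ofReal s)) :=
    ENNReal.Tendsto.const_mul
      ((ENNReal.continuous_ofReal.tendsto s).mono_left nhdsWithin_le_nhds)
      (Or.inl (ENNReal.ofReal_pos.2 hs0).ne')
  refine le_of_tendsto hc ?_
  filter_upwards [Ioo_mem_nhdsLT hs0] with x hx
  exact (H.le_maxDual_of_lt_infPhi hx.1.le hm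
    (((ENNReal.ofReal_lt_ofReal_iff hs0).2 hx.2).trans_le h)).trans (maxDual_mono hx.2.le)

/-- If all geodesics are shorter than `s`, then no turning height is better than `0`. -/
theorem le_maxDual_of_supPhi_lt (H : M.Regular) {s m : ℝ} (hs : 0 ≤ s) (hm : m ∈ Ioo (0 : ℝ) 1)
    (h : M.supPhi < ENNReal.ofReal s) : ENNReal.ofReal (2 * M.Psi 1) ≤ M.maxDual s m := by
  by_contra! hlt
  have hev := (H.tendsto_maxDual_zero hs).eventually_const_lt hlt
  obtain ⟨r, hr, hev⟩ := (mem_nhdsGT_iff_exists_Ioo_subset' hm.1).1 hev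
  obtain ⟨z, hz, -, hmin⟩ := ((H.lowerSemicontinuousOn_maxDual s).mono
    (fun y (hy : y ∈ Icc (min m r) m) => ⟨(lt_min hm.1 hr).trans_le hy.1, hy.2.trans_lt hm.2⟩)
    ).exists_isMinOn_of_lt (I := Ioc 0 m) isCompact_Icc (right_mem_Icc.2 (min_le_left m r))
    fun y hy hyJ => hev ⟨hy.1, (not_le.1 fun hle => hyJ ⟨hle, hy.2⟩).trans_le (min_le_right m r)⟩
  have hzI : z ∈ Ioo (0 : ℝ) 1 := ⟨(lt_min hm.1 hr).trans_le hz.1, hz.2.trans_lt hm.2⟩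
  obtain ⟨m', hm', hlt'⟩ := H.exists_lt_maxDual_lt hs hzI
    ((le_iSup₂ (f := fun x (_ : x ∈ Ioo (0 : ℝ) 1) => M.Phi x) z hzI).trans_lt h)
  exact (hmin m' ⟨hm'.1, hm'.2.le.trans hz.2⟩).not_gt hlt'

theorem le_maxDual_of_supPhi_le (H : M.Regular) {s m : ℝ} (hs : 0 ≤ s) (hm : m ∈ Ioo (0 : ℝ) 1)
    (h : M.supPhi ≤ ENNReal.ofReal s) : ENNReal.ofReal (2 * M.Psi 1) ≤ M.maxDual s m := by
  have hc : Tendsto (fun x => M.maxDual s m + ENNReal.ofReal (Real.sqrt (M.khat m) * (x - s)))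
      (𝓝[>] s) (𝓝 (M.maxDual s m + ENNReal.ofReal 0)) := by
    refine tendsto_const_nhds.add (ENNReal.tendsto_ofReal (Tendsto.mono_left ?_ nhdsWithin_le_nhds))
    exact Continuous.tendsto' (by fun_prop) _ _ (by simp)
  rw [ENNReal.ofReal_zero, add_zero] at hc
  refine ge_of_tendsto hc ?_
  filter_upwards [self_mem_nhdsWithin] with x hx
  have hx0 : 0 < x := hs.trans_lt hx
  exact (H.le_maxDual_of_supPhi_lt hx0.le hm
    (h.trans_lt ((ENNReal.ofReal_lt_ofReal_iff hx0).2 hx))).trans (maxDual_le_add (le_of_lt hx))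

/-- The turning heights of the optimal paths are `0`, `1` and the solutions of `Φ(m) = s`. -/
theorem le_maxDual_of_forall_Phi_eq (H : M.Regular) {s m : ℝ} {K : ℝ≥0∞} (hs : 0 ≤ s)
    (hm : m ∈ Ioo (0 : ℝ) 1) (h0 : K ≤ ENNReal.ofReal (2 * M.Psi 1))
    (h1 : K ≤ M.σ * ENNReal.ofReal s)
    (hK : ∀ z ∈ Ioo (0 : ℝ) 1, M.Phi z = ENNReal.ofReal s → K ≤ M.maxDual s z) :
    K ≤ M.maxDual s m := by
  by_contra! hlt
  have hev0 := (H.tendsto_maxDual_zero hs).eventually_const_lt (hlt.trans_le h0)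
  have hev1 := (H.tendsto_maxDual_one hs).eventually_const_lt (hlt.trans_le h1)
  obtain ⟨r₀, hr₀, hev0⟩ := (mem_nhdsGT_iff_exists_Ioo_subset' hm.1).1 hev0
  obtain ⟨r₁, hr₁, hev1⟩ := (mem_nhdsLT_iff_exists_Ioo_subset' hm.2).1 hev1
  obtain ⟨z, hz, hzm, hmin⟩ := ((H.lowerSemicontinuousOn_maxDual s).mono
    (fun y (hy : y ∈ Icc (min m r₀) (max m r₁)) =>
      ⟨(lt_min hm.1 hr₀).trans_le hy.1, hy.2.trans_lt (max_lt hm.2 hr₁)⟩)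
    ).exists_isMinOn_of_lt (I := Ioo 0 1) (x := m) isCompact_Icc
    ⟨min_le_left m r₀, le_max_left m r₁⟩ fun y hy hyJ => by
      rcases lt_or_ge y (min m r₀) with hlt' | hge
      · exact hev0 ⟨hy.1, hlt'.trans_le (min_le_right m r₀)⟩
      · exact hev1 ⟨(le_max_right m r₁).trans_lt (not_le.1 fun hle => hyJ ⟨hge, hle⟩), hy.2⟩
  have hzI : z ∈ Ioo (0 : ℝ) 1 := ⟨(lt_min hm.1 hr₀).trans_le hz.1, hz.2.trans_lt (max_lt hm.2 hr₁)⟩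
  rcases lt_trichotomy (M.Phi z) (ENNReal.ofReal s) with hlt' | heq | hgt
  · obtain ⟨m', hm', h'⟩ := H.exists_lt_maxDual_lt hs hzI hlt'
    exact (hmin m' ⟨hm'.1, hm'.2.trans hzI.2⟩).not_gt h'
  · exact ((hK z hzI heq).trans hzm).not_gt hlt
  · obtain ⟨m', hm', h'⟩ := H.exists_gt_maxDual_lt hs hzI hgt
    exact (hmin m' ⟨hzI.1.trans hm'.1, hm'.2⟩).not_gt h'

theorem g_le_zero_height (H : M.Regular) {s : ℝ} (hs : 0 ≤ s) :
    M.g s ≤ ENNReal.ofReal (2 * M.Psi 1) :=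
  le_of_tendsto_maxDual (Ioo_mem_nhdsGT zero_lt_one) (H.tendsto_maxDual_zero hs)
    fun _ hm => H.g_le_maxDual hm hs

theorem g_le_one_height (H : M.Regular) {s : ℝ} (hs : 0 ≤ s) : M.g s ≤ M.σ * ENNReal.ofReal s :=
  le_of_tendsto_maxDual (Ioo_mem_nhdsLT zero_lt_one) (H.tendsto_maxDual_one hs)
    fun _ hm => H.g_le_maxDual hm hs

theorem tendsto_frakG_zero (H : M.Regular) {s : ℝ} (hs : 0 ≤ s) :
    Tendsto (fun m => M.frakG s m) (𝓝[>] 0) (𝓝 (ENNReal.ofReal (2 * M.Psi 1))) :=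
  (H.tendsto_maxDual_zero hs).congr' (by
    filter_upwards [Ioo_mem_nhdsGT (zero_lt_one' ℝ)] with m hm
      using (H.frakG_eq_maxDual hm hs).symm)

theorem tendsto_frakG_one (H : M.Regular) {s : ℝ} (hs : 0 ≤ s) :
    Tendsto (fun m => M.frakG s m) (𝓝[<] 1) (𝓝 (M.σ * ENNReal.ofReal s)) :=
  (H.tendsto_maxDual_one hs).congr' (by
    filter_upwards [Ioo_mem_nhdsLT (zero_lt_one' ℝ)] with m hm
      using (H.frakG_eq_maxDual hm hs).symm)

theorem g_eq_of_le_infPhi (H : M.Regular) {s : ℝ≥0} (h : (s : ℝ≥0∞) ≤ M.infPhi) :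
    M.g s = M.σ * s := by
  have hs : (0 : ℝ) ≤ s := s.coe_nonneg
  rw [← ENNReal.ofReal_coe_nnreal] at h ⊢
  exact le_antisymm (H.g_le_one_height hs)
    (H.le_g hs fun m hm => H.le_maxDual_of_le_infPhi hs hm h)

/-- Some s > 0 below inf Φ would give ∞ = σs ≤ `maxDual s (1/2)`, which is finite. -/
theorem infPhi_eq_zero (H : M.Regular) (h : M.σ = ⊤) : M.infPhi = 0 := by
  by_contra hne
  obtain ⟨s, hs0, hs⟩ := ENNReal.lt_iff_exists_nnreal_btwn.1 (pos_iff_ne_zero.2 hne)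
  have hm : (1 / 2 : ℝ) ∈ Ioo (0 : ℝ) 1 := by norm_num
  rw [← ENNReal.ofReal_coe_nnreal] at hs hs0
  have := H.le_maxDual_of_lt_infPhi s.coe_nonneg hm hs
  rw [h, ENNReal.top_mul hs0.ne', top_le_iff] at this
  exact H.maxDual_ne_top s.coe_nonneg ⟨hm.1.le, hm.2⟩ this

theorem g_eq_of_supPhi_le (H : M.Regular) {s : ℝ≥0} (h : M.supPhi ≤ s) :
    M.g s = ENNReal.ofReal (2 * M.Psi 1) := by
  have hs : (0 : ℝ) ≤ s := s.coe_nonneg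
  rw [← ENNReal.ofReal_coe_nnreal] at h
  exact le_antisymm (H.g_le_zero_height hs)
    (H.le_g hs fun m hm => H.le_maxDual_of_supPhi_le hs hm h)

theorem g_eq_min (H : M.Regular) (s : ℝ≥0) :
    M.g s = (⨅ m ∈ {m : ℝ | m ∈ Ioo (0 : ℝ) 1 ∧ M.Phi m = s}, M.frakG s m)
      ⊓ liminf (fun m : ℝ => M.frakG s m) (𝓝[>] 0)
      ⊓ liminf (fun m : ℝ => M.frakG s m) (𝓝[<] 1) := by
  have hs : (0 : ℝ) ≤ s := s.coe_nonneg
  rw [(H.tendsto_frakG_zero hs).liminf_eq, (H.tendsto_frakG_one hs).liminf_eq]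
  refine le_antisymm (le_inf (le_inf (le_iInf₂ fun m hm => ?_) (H.g_le_zero_height hs))
    (H.g_le_one_height hs)) (H.le_g hs fun m hm => ?_)
  · rw [H.frakG_eq_maxDual hm.1 hs]
    exact H.g_le_maxDual hm.1 hs
  · refine H.le_maxDual_of_forall_Phi_eq hs hm (inf_le_left.trans inf_le_right) inf_le_right
      fun z hz hPhi => ?_
    rw [ENNReal.ofReal_coe_nnreal] at hPhi
    rw [← H.frakG_eq_maxDual hz hs]
    exact (inf_le_left.trans inf_le_left).trans (iInf₂_le z ⟨hz, hPhi⟩)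

/-- For r < t < inf Φ one has g(r) = σr < σt = g(t) ≤ 2Ψ(1), the intermediate t supplying
strictness; σ is finite because g(t) is. Above sup Φ the value 2Ψ(1) is attained. -/
theorem sFrac_mem (H : M.Regular) : M.sFrac ∈ Icc M.infPhi M.supPhi := by
  refine ⟨ENNReal.le_of_forall_nnreal_lt fun r hr => ?_, iSup₂_le fun s hs => ?_⟩
  · obtain ⟨t, hrt, ht⟩ := ENNReal.lt_iff_exists_nnreal_btwn.1 hr
    have h1 := H.g_le_zero_height t.coe_nonneg
    rw [H.g_eq_of_le_infPhi ht.le] at h1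
    have ht0 : (t : ℝ≥0∞) ≠ 0 := (bot_le.trans_lt hrt).ne'
    have hσ : M.σ ≠ ⊤ := fun h => by
      rw [h, ENNReal.top_mul ht0] at h1
      exact ENNReal.ofReal_ne_top (top_le_iff.1 h1)
    refine le_iSup₂ (f := fun (s : ℝ≥0) (_ : M.g s < ENNReal.ofReal (2 * M.Psi 1)) => (s : ℝ≥0∞))
      r ?_
    rw [H.g_eq_of_le_infPhi hr.le]
    exact ((ENNReal.mul_lt_mul_iff_right H.σ_pos.ne' hσ).2 hrt).trans_le h1
  · by_contra! hlt
    exact hs.ne (H.g_eq_of_supPhi_le hlt.le)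

theorem σ_eq_top (H : M.Regular) (h : Tendsto M.khat (𝓝[<] 1) atTop) : M.σ = ⊤ := by
  have := tendsto_nhds_unique H.tendsto_khat (ENNReal.tendsto_ofReal_atTop.comp h)
  simpa using this

end CohesiveFracture.Model.Regular

theorem mainTheorem9 (M : CohesiveFracture.Model)
    (h1 : M.Hp1) (h2 : M.Hp2) (h3 : M.Hp3) (h4 : M.Hp4)
    (hφ : M.phiPrime = 1) (h5 : M.Hp5') :
    (∀ s : ℝ≥0, (s : ℝ≥0∞) ≤ M.infPhi → M.g s = M.σ * s) ∧
    (Tendsto M.khat (𝓝[<] 1) atTop → M.infPhi = 0) ∧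
    (∀ s : ℝ≥0, M.infPhi < s → (s : ℝ≥0∞) < M.supPhi →
      M.g s = (⨅ m ∈ {m : ℝ | m ∈ Ioo (0 : ℝ) 1 ∧ M.Phi m = s}, M.frakG s m)
        ⊓ liminf (fun m : ℝ => M.frakG s m) (𝓝[>] 0)
        ⊓ liminf (fun m : ℝ => M.frakG s m) (𝓝[<] 1)) ∧
    (∀ s : ℝ≥0, M.supPhi ≤ s → M.g s = ENNReal.ofReal (2 * M.Psi 1)) ∧
    M.sFrac ∈ Icc M.infPhi M.supPhi := by
  have H := CohesiveFracture.Model.regular_of_hypotheses h1 h2 hφ h5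
  exact ⟨fun s hs => H.g_eq_of_le_infPhi hs, fun h => H.infPhi_eq_zero (H.σ_eq_top h),
    fun s _ _ => H.g_eq_min s, fun s hs => H.g_eq_of_supPhi_le hs, H.sFrac_mem⟩
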